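/- Let $\mathbb F_q$ be a finite field of odd characteristic, let $n$ be a prime number, and let $C: y^2=f(x)$ be an elliptic or hyperelliptic curve of genus $g\ge 1$ over $\mathbb F_q$, where $f\in\mathbb F_q[x]$ is monic of degree $2g+1$ without multiple zeros. Let $O$ be the point at infinity, $w(X,Y)=(X,-Y)$ the hyperelliptic involution, $\varphi(X,Y)=(X^q,Y^q)$ the Frobenius map (both extended to divisors on $C$ over $\overline{\mathbb F}_q$), and $\mathrm{Tr}(D)=D+\varphi(D)+\dots+\varphi^{n-1}(D)$. A divisor $D=P_1+\dots+P_r-rO$ with affine points $P_i\in C(\overline{\mathbb F}_q)$ is called reduced if $r\le g$ and $P_i\ne w(P_j)$ for $i\neq j$; put $u(x)=\prod_{i=1}^r(x-x(P_i))$, the first polynomial of the Mumford representation $[u,v]$ of $D$. A reduced divisor $D$ is $\mathbb F_{q^n}$-rational if $\varphi^n(D)=D$, and then it is prime (over $\mathbb F_{q^n}$) if its polynomial $u$ is irreducible in $\mathbb F_{q^n}[x]$. Let $N(u)=u\,u^{\varphi}\cdots u^{\varphi^{n-1}}$, where $\varphi$ acts on the coefficients. Let $D=P_1+\dots+P_r-rO$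 be an $\mathbb F_{q^n}$-rational reduced divisor whose class lies in the trace zero subgroup $T_n$, i.e. $\mathrm{Tr}(D)$ is principal over $\overline{\mathbb F}_q$. Then $D$ is a sum $D=D_1+\dots+D_t$ of reduced prime divisors over $\mathbb F_{q^n}$. There is a function $h_D\in\mathbb F_q(C)$ with $\mathrm{div}(h_D)=\mathrm{Tr}(D)$; it is unique up to multiplication by a constant in $\mathbb F_q^*$. For every such $h_D$ the following hold. (i) $h_D=h_{D,1}(x)+y\,h_{D,2}(x)$ with $h_{D,1},h_{D,2}\in\mathbb F_q[x]$. (ii) $H_D(x):=h_{D,1}(x)^2-f(x)h_{D,2}(x)^2\in\mathbb F_q[x]$ has degree $rn$, its zeros in $\overline{\mathbb F}_q$ are exactly the $x$-coordinates of the points $\varphi^j(P_i)$, $1\le i\le r$, $0\le j\le n-1$, and $H_D=c\,N(u)$ for some constant $c\in\mathbb F_q^*$. (iii) $\deg h_{D,1}\le\lfloor\frac{nr}{2}\rfloor$ and $\deg h_{D,2}\le\lfloor\frac{nr-2g-1}{2}\rfloor$ (with $\deg 0=-\infty$). Equality holds for $h_{D,1}$ if $r$ is even or $n=2$, and equality holds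 for $h_{D,2}$ if $r$ is odd and $n\ne2$. (iv) Let $F$ be a reduced divisor and let $D=D_1+\dots+D_t$ be a decomposition into reduced prime divisors over $\mathbb F_{q^n}$. Then there is a function $h_F\in\mathbb F_q(C)$ with $\mathrm{div}(h_F)=\mathrm{Tr}(F)$ that agrees with $h_D$ up to a constant in $\mathbb F_q^*$ if and only if $F=\varphi^{j_1}(D_1)+\dots+\varphi^{j_t}(D_t)$ for some $0\le j_1,\dots,j_t\le n-1$. In particular, at most $n^g$ reduced divisors $F$ have such a function $h_F$. -/

import Mathlib

open Polynomial

/-- An elliptic or hyperelliptic curve `y ^ 2 = f(x)` of genus `g ≥ 1` over a field `k` of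
characteristic different from `2`, with a rational Weierstrass point at infinity:
`f` is monic of degree `2 * g + 1` and has no multiple zeros. -/
structure HypCurve (k : Type*) [Field k] where
  /-- the genus -/
  g : ℕ
  /-- the polynomial in the equation `y ^ 2 = f(x)` -/
  f : k[X]
  one_le_g : 1 ≤ g
  two_ne_zero : (2 : k) ≠ 0
  monic : f.Monic
  natDegree_eq : f.natDegree = 2 * g + 1
  separable : f.Separable

/-! ### Plane double covers `y ^ 2 = p(x)` of the affine line -/

/-- The ring `K[x, y] / (y ^ 2 - p(x))`. -/
abbrev DoubleCover {K : Type*} [Field K] (p : K[X]) : Type _ :=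
  AdjoinRoot (X ^ 2 - C p : K[X][X])

namespace DoubleCover

variable {K : Type*} [Field K]

/-- Evaluation of functions at a point `(a, b)` with `b ^ 2 = p(a)`. -/
noncomputable def evalAt (p : K[X]) (a b : K) (h : b ^ 2 = p.eval a) : DoubleCover p →+* K :=
  AdjoinRoot.lift (evalRingHom a) b (by simp [h])

/-- The maximal ideal of the functions that vanish at the point `(a, b)`. -/
noncomputable def pointIdeal (p : K[X]) (a b : K) (h : b ^ 2 = p.eval a) :
    Ideal (DoubleCover p) :=
  RingHom.ker (evalAt p a b h)

end DoubleCover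

/-- `HasOrder m a i` says that the element `a` vanishes to order exactly `i` along `m`, that is,
`a` lies in `m ^ i` and not in `m ^ (i + 1)`. For the maximal ideal `m` of a point on a smooth
affine curve, this is the order of vanishing of the function `a` at that point. -/
def HasOrder {R : Type*} [CommRing R] (m : Ideal R) (a : R) (i : ℕ) : Prop :=
  a ∈ m ^ i ∧ a ∉ m ^ (i + 1)

/-- Let `ψ` embed the coordinate ring `R` of an affine chart into the function field `F`, and let
`m` be the maximal ideal of a point of the chart. `HasFracOrder ψ m h d` says that the rational
function `h`, written as a quotient `a / b` of elements of `R`, has order `d` at that point. -/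
def HasFracOrder {R F : Type*} [CommRing R] [CommRing F] (ψ : R →+* F) (m : Ideal R) (h : F)
    (d : ℤ) : Prop :=
  ∃ (a b : R) (i j : ℕ), HasOrder m a i ∧ HasOrder m b j ∧ h * ψ b = ψ a ∧ d = (i : ℤ) - j

namespace HypCurve

variable {k : Type*} [Field k] (C : HypCurve k) (K : Type*) [Field K] [Algebra k K]

/-! ### Points -/

/-- A `K`-valued point of the affine curve `y ^ 2 = f(x)`. -/
@[ext]
structure AffinePoint where
  x : K
  y : K
  eqn : y ^ 2 = aeval x C.f

/-- The `K`-valued points of the projective curve; `none` is the point at infinity. -/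
abbrev Point : Type _ := Option (C.AffinePoint K)

variable {C K}

/-- The hyperelliptic involution `(x, y) ↦ (x, -y)` on affine points. -/
def AffinePoint.w (P : C.AffinePoint K) : C.AffinePoint K :=
  ⟨P.x, -P.y, by rw [neg_sq]; exact P.eqn⟩

/-- An endomorphism `σ` of `K` over `k` acts on affine points coordinatewise. -/
def AffinePoint.map (σ : K →ₐ[k] K) (P : C.AffinePoint K) : C.AffinePoint K :=
  ⟨σ P.x, σ P.y, by rw [← map_pow, P.eqn, Polynomial.aeval_algHom_apply]⟩

/-- The action of `σ` on points; the point at infinity is fixed. -/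
def Point.map (σ : K →ₐ[k] K) : C.Point K → C.Point K :=
  Option.map (AffinePoint.map σ)

variable (C K)

/-! ### Function field -/

/-- The affine coordinate ring `K[x, y] / (y ^ 2 - f(x))`. -/
abbrev CoordRing : Type _ := DoubleCover (C.f.map (algebraMap k K))

theorem prime_equation : Prime (X ^ 2 - Polynomial.C (C.f.map (algebraMap k K)) : K[X][X]) := by
  have hm : (X ^ 2 - Polynomial.C (C.f.map (algebraMap k K)) : K[X][X]).Monic :=
    monic_X_pow_sub_C _ (by norm_num)
  have hd : (X ^ 2 - Polynomial.C (C.f.map (algebraMap k K)) : K[X][X]).natDegree = 2 :=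
    natDegree_X_pow_sub_C
  refine Irreducible.prime ?_
  rw [hm.irreducible_iff_roots_eq_zero_of_degree_le_three (by omega) (by omega)]
  rw [Multiset.eq_zero_iff_forall_notMem]
  intro a ha
  have h := (mem_roots'.1 ha).2
  simp only [IsRoot.def, eval_sub, eval_pow, eval_X, eval_C, sub_eq_zero] at h
  have h2 := congrArg natDegree h
  rw [natDegree_pow, natDegree_map, C.natDegree_eq] at h2
  omega

instance : IsDomain (C.CoordRing K) := AdjoinRoot.isDomain_of_prime (C.prime_equation K)

/-- The function field `K(C)`. -/
abbrev FunctionField : Type _ := FractionRing (C.CoordRing K)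

/-- The coordinate function `x`. -/
noncomputable def xFun : C.FunctionField K :=
  algebraMap (C.CoordRing K) (C.FunctionField K) (AdjoinRoot.of _ X)

/-- The coordinate function `y`. -/
noncomputable def yFun : C.FunctionField K :=
  algebraMap (C.CoordRing K) (C.FunctionField K) (AdjoinRoot.root _)

/-- The field `k(C) = k(x, y)` of the functions defined over `k`, inside `K(C)`. -/
noncomputable def baseFunctionField : IntermediateField k (C.FunctionField K) :=
  IntermediateField.adjoin k {C.xFun K, C.yFun K}

theorem algebraMap_of (p : K[X]) :
    algebraMap (C.CoordRing K) (C.FunctionField K) (AdjoinRoot.of _ p) = aeval (C.xFun K) p := by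
  have h : (algebraMap (C.CoordRing K) (C.FunctionField K)).comp (AdjoinRoot.of _) =
      (aeval (C.xFun K) : K[X] →ₐ[K] C.FunctionField K).toRingHom := by
    refine Polynomial.ringHom_ext (fun a => ?_) ?_
    · simp only [AlgHom.toRingHom_eq_coe, RingHom.coe_comp, RingHom.coe_coe, Function.comp_apply,
        aeval_C]
      rfl
    · simp [xFun]
  exact congrArg (fun φ => φ p) h

theorem xFun_ne_zero : C.xFun K ≠ 0 := by
  have h1 : Function.Injective (AdjoinRoot.of
      (X ^ 2 - Polynomial.C (C.f.map (algebraMap k K)) : K[X][X])) := by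
    refine AdjoinRoot.of.injective_of_degree_ne_zero ?_
    rw [degree_X_pow_sub_C (by norm_num)]
    norm_num
  have h2 := IsFractionRing.injective (C.CoordRing K) (C.FunctionField K)
  intro h
  refine X_ne_zero (R := K) (h1 (h2 ?_))
  rw [map_zero, map_zero]
  exact h

theorem yFun_sq : C.yFun K ^ 2 = aeval (C.xFun K) (C.f.map (algebraMap k K)) := by
  rw [← algebraMap_of, yFun, ← map_pow]
  congr 1
  have h := AdjoinRoot.eval₂_root (X ^ 2 - Polynomial.C (C.f.map (algebraMap k K)) : K[X][X])
  rw [eval₂_sub, eval₂_pow, eval₂_X, eval₂_C, sub_eq_zero] at h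
  exact h

/-- In the coordinates `z = 1 / x`, `w = y / x ^ (g + 1)`, the curve has the equation
`w ^ 2 = infPoly(z)` near the point at infinity, which is the point `(z, w) = (0, 0)`. -/
noncomputable def infPoly : K[X] := X * (C.f.map (algebraMap k K)).reverse

/-- The embedding into the function field of the coordinate ring of the chart at infinity, given by
`z ↦ 1 / x` and `w ↦ y / x ^ (g + 1)`. -/
noncomputable def infEmb : DoubleCover (C.infPoly K) →+* C.FunctionField K :=
  AdjoinRoot.lift ((aeval (C.xFun K)⁻¹ : K[X] →ₐ[K] C.FunctionField K) : K[X] →+* _)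
    (C.yFun K / C.xFun K ^ (C.g + 1)) (by
      have hx := C.xFun_ne_zero K
      let _ : Invertible (C.xFun K) := invertibleOfNonzero hx
      have h := eval₂_reverse_mul_pow (algebraMap K (C.FunctionField K)) (C.xFun K)
        (C.f.map (algebraMap k K))
      rw [natDegree_map, C.natDegree_eq, invOf_eq_inv] at h
      rw [eval₂_sub, eval₂_pow, eval₂_X, eval₂_C, sub_eq_zero, div_pow, yFun_sq, infPoly,
        RingHom.coe_coe, map_mul, aeval_X, aeval_def, ← h, aeval_def]
      generalize eval₂ (algebraMap K (C.FunctionField K)) (C.xFun K)⁻¹ _ = s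
      field_simp
      ring)

/-! ### Divisors -/

/-- Divisors: finite formal sums of points. -/
abbrev Divisor : Type _ := C.Point K →₀ ℤ

variable {C K}

/-- The function `h` has order `d` at the point `P`. -/
def HasOrderAt (h : C.FunctionField K) : C.Point K → ℤ → Prop
  | none, d => HasFracOrder (C.infEmb K)
      (DoubleCover.pointIdeal (C.infPoly K) 0 0 (by simp [infPoly])) h d
  | some P, d => HasFracOrder (algebraMap (C.CoordRing K) (C.FunctionField K))
      (DoubleCover.pointIdeal _ P.x P.y (by rw [P.eqn, eval_map_algebraMap])) h d

/-- `div(h) = D`. -/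
def HasDivisor (h : C.FunctionField K) (D : C.Divisor K) : Prop :=
  ∀ P : C.Point K, HasOrderAt h P (D P)

/-- Principal divisors, `D ∼ 0`. -/
def IsPrincipal (D : C.Divisor K) : Prop :=
  ∃ h : C.FunctionField K, h ≠ 0 ∧ HasDivisor h D

/-- The additive action of an endomorphism of `K` over `k` on divisors. -/
noncomputable def Divisor.map (σ : K →ₐ[k] K) (D : C.Divisor K) : C.Divisor K :=
  Finsupp.mapDomain (Point.map σ) D

/-- The divisor `P₁ + … + Pᵣ - r O`. -/
noncomputable def divisorOf {r : ℕ} (P : Fin r → C.AffinePoint K) : C.Divisor K :=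
  ∑ i, Finsupp.single (some (P i)) (1 : ℤ) - Finsupp.single none (r : ℤ)

/-- `P₁ + … + Pᵣ - r O` is a reduced divisor: `r ≤ g`, and `Pᵢ ≠ w(Pⱼ)` for `i ≠ j`. -/
def IsReducedFamily {r : ℕ} (P : Fin r → C.AffinePoint K) : Prop :=
  r ≤ C.g ∧ ∀ i j, i ≠ j → P i ≠ (P j).w

/-- Reduced divisors. -/
def IsReduced (D : C.Divisor K) : Prop :=
  ∃ (r : ℕ) (P : Fin r → C.AffinePoint K), IsReducedFamily P ∧ D = divisorOf P

/-- The first polynomial `u = ∏ (x - x(Pᵢ))` of the Mumford representation `[u, v]` of the divisor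
`P₁ + … + Pᵣ - r O`. -/
noncomputable def mumfordU {r : ℕ} (P : Fin r → C.AffinePoint K) : K[X] :=
  ∏ i, (X - Polynomial.C (P i).x)

section Frobenius

variable [Fintype k]

/-- The action of the `j`-th power of the `q`-Frobenius on divisors, where `q` is the order
of `k`. -/
noncomputable def frob (j : ℕ) (D : C.Divisor K) : C.Divisor K :=
  D.map (FiniteField.frobeniusAlgHom k K ^ j)

/-- The divisor `D` is rational over the extension of degree `n` of `k`. -/
def IsRational (n : ℕ) (D : C.Divisor K) : Prop := frob n D = D

/-- The trace `D + φ(D) + … + φ ^ (n - 1) (D)`. -/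
noncomputable def trace (n : ℕ) (D : C.Divisor K) : C.Divisor K :=
  ∑ j ∈ Finset.range n, frob j D

/-- `D` is rational over the extension of degree `n` of `k`, and `Tr(D) ∼ 0`: the class of `D`
lies in the trace zero subgroup `T_n`. -/
def IsTraceZero (n : ℕ) (D : C.Divisor K) : Prop :=
  IsRational n D ∧ IsPrincipal (trace n D)

/-- The reduced prime divisors over the extension `L` of degree `n` of `k`: the reduced divisors,
rational over `L`, whose first Mumford polynomial `u` is an irreducible polynomial of `L[x]`. -/
def IsPrimeDivisor (n : ℕ) (L : Type*) [Field L] [Algebra L K] (D : C.Divisor K) : Prop :=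
  IsRational n D ∧ ∃ (r : ℕ) (P : Fin r → C.AffinePoint K), IsReducedFamily P ∧ D = divisorOf P ∧
    ∃ u : L[X], Irreducible u ∧ u.map (algebraMap L K) = mumfordU P

end Frobenius

end HypCurve

/-- The norm `u * u ^ φ * … * u ^ (φ ^ (n - 1))`, where the `q`-Frobenius `φ` acts on the
coefficients. -/
noncomputable def frobNorm (k : Type*) {K : Type*} [Field k] [Fintype k] [Field K] [Algebra k K]
    (n : ℕ) (u : K[X]) : K[X] :=
  ∏ j ∈ Finset.range n, u.map ((FiniteField.frobeniusAlgHom k K ^ j : K →ₐ[k] K) : K →+* K)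

/-! Over the algebraically closed field `K` the affine coordinate ring K[x, y] / (y² - f) is a
Dedekind domain whose nonzero primes are exactly the ideals of the affine points
(`exists_eq_pointIdeal`, `isDedekindDomain`). Since deg f is odd, leading terms never cancel in the
norm s² - f t² of s + y t (`degree_norm`), so the only units are the nonzero constants. Hence a
function without affine poles has the form s + y t, and the multiset of its affine zeros determines
it up to a constant (`exists_eq_algebraMap_of_hasOrderAt`, `eq_C_mul_of_span_eq`).

Tr(D) is stable under Frobenius, so Frobenius multiplies a function with this divisor by a constant;
dividing by a leading coefficient moves all coefficients into `k` (`exists_const_mul_mem_base`).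
This gives existence and (i). For (ii), multiply the function by its conjugate: the ideals of P and
w(P) have product (x - x(P)), so the norm is a constant times the product of these linear factors
over Tr(D) (`norm_eq_prod`). For (iii), the degree rn of the norm is the maximum of the even number
2 deg s and the odd number 2g + 1 + 2 deg t, and its parity tells which term attains it.

For (iv), h_F and h_D agree up to a constant exactly when the traces agree as multisets of affine
points. A multiset stable under φⁿ is a sum of φⁿ-orbits, and prime divisors are single orbits
(`isPrimeDivisor_orbit`, `IsPrimeDivisor.exists_orbit`). Equality of traces forces F to be stable
under φⁿ too, and translates of the orbits of D can then be removed from F one by one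
(`exists_eq_sum_map_iterate`). The bound follows because D has at most r ≤ g orbits, each with n
translates. -/

namespace DoubleCover

/-! ### Normal form s + y t, point ideals and the Dedekind property -/

variable {K : Type*} [Field K]

/-- The function `s(x) + y * t(x)`. -/
noncomputable def elem (p s t : K[X]) : DoubleCover p :=
  AdjoinRoot.of _ s + AdjoinRoot.root _ * AdjoinRoot.of _ t

variable {p : K[X]}

theorem root_sq : (AdjoinRoot.root (X ^ 2 - C p : K[X][X])) ^ 2 = AdjoinRoot.of _ p := by
  have h := AdjoinRoot.eval₂_root (X ^ 2 - C p : K[X][X])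
  rw [eval₂_sub, eval₂_pow, eval₂_X, eval₂_C, sub_eq_zero] at h
  exact h

theorem elem_zero_right (s : K[X]) : elem p s 0 = AdjoinRoot.of _ s := by simp [elem]

theorem elem_zero : elem p 0 0 = 0 := by simp [elem]

theorem elem_mul (s t s' t' : K[X]) :
    elem p s t * elem p s' t' = elem p (s * s' + p * t * t') (s * t' + t * s') := by
  simp only [elem, map_add, map_mul, ← root_sq]
  ring

theorem elem_add (s t s' t' : K[X]) :
    elem p s t + elem p s' t' = elem p (s + s') (t + t') := by
  simp only [elem, map_add]
  ring

theorem exists_elem (z : DoubleCover p) : ∃ s t : K[X], z = elem p s t := by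
  obtain ⟨g, rfl⟩ := AdjoinRoot.mk_surjective z
  have hm : (X ^ 2 - C p : K[X][X]).Monic := monic_X_pow_sub_C _ (by norm_num)
  have hd : (X ^ 2 - C p : K[X][X]).natDegree = 2 := natDegree_X_pow_sub_C
  have h1 : (g %ₘ (X ^ 2 - C p)).natDegree < 2 := by
    refine lt_of_lt_of_eq (natDegree_modByMonic_lt g hm fun h => ?_) hd
    rw [h, natDegree_one] at hd
    omega
  have h2 := eq_X_add_C_of_natDegree_le_one (Nat.le_of_lt_succ h1)
  have h3 : AdjoinRoot.mk (X ^ 2 - C p) g = AdjoinRoot.mk (X ^ 2 - C p) (g %ₘ (X ^ 2 - C p)) := by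
    rw [AdjoinRoot.mk_eq_mk]
    refine ⟨g /ₘ (X ^ 2 - C p), ?_⟩
    rw [sub_eq_iff_eq_add, add_comm, modByMonic_add_div]
  refine ⟨(g %ₘ (X ^ 2 - C p)).coeff 0, (g %ₘ (X ^ 2 - C p)).coeff 1, ?_⟩
  rw [h3]
  nth_rw 1 [h2]
  simp only [elem, map_add, map_mul, AdjoinRoot.mk_C, AdjoinRoot.mk_X]
  ring

theorem elem_eq_zero {s t : K[X]} (h : elem p s t = 0) : s = 0 ∧ t = 0 := by
  have hm : (X ^ 2 - C p : K[X][X]).Monic := monic_X_pow_sub_C _ (by norm_num)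
  have h1 : elem p s t = AdjoinRoot.mk (X ^ 2 - C p) (C s + X * C t) := by
    rw [elem, map_add, map_mul, AdjoinRoot.mk_C, AdjoinRoot.mk_X, AdjoinRoot.mk_C]
  by_contra hne
  have h0 : (C s + X * C t : K[X][X]) ≠ 0 := by
    intro h0
    refine hne ⟨?_, ?_⟩
    · simpa using congrArg (fun u => coeff u 0) h0
    · simpa [coeff_C] using congrArg (fun u => coeff u 1) h0
  refine AdjoinRoot.mk_ne_zero_of_degree_lt hm h0 ?_ (h1.symm.trans h)
  rw [degree_X_pow_sub_C (by norm_num)]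
  refine lt_of_le_of_lt (degree_add_le _ _) (max_lt ?_ ?_)
  · exact lt_of_le_of_lt degree_C_le (by norm_num)
  · rw [mul_comm]
    exact lt_of_le_of_lt (degree_C_mul_X_le _) (by norm_num)

theorem elem_inj {s t s' t' : K[X]} : elem p s t = elem p s' t' ↔ s = s' ∧ t = t' := by
  refine ⟨fun h => ?_, fun h => by rw [h.1, h.2]⟩
  have h1 : elem p (s - s') (t - t') = 0 := by
    have h2 := sub_eq_zero.2 h
    rw [← h2]
    simp only [elem, map_sub]
    ring
  obtain ⟨h3, h4⟩ := elem_eq_zero h1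
  exact ⟨sub_eq_zero.1 h3, sub_eq_zero.1 h4⟩

theorem evalAt_elem (a b : K) (h : b ^ 2 = p.eval a) (s t : K[X]) :
    evalAt p a b h (elem p s t) = s.eval a + b * t.eval a := by
  simp [elem, evalAt]

theorem mem_pointIdeal {a b : K} {h : b ^ 2 = p.eval a} {s t : K[X]} :
    elem p s t ∈ pointIdeal p a b h ↔ s.eval a + b * t.eval a = 0 := by
  rw [pointIdeal, RingHom.mem_ker, evalAt_elem]

theorem evalAt_surjective (a b : K) (h : b ^ 2 = p.eval a) :
    Function.Surjective (evalAt p a b h) := fun c => ⟨elem p (C c) 0, by simp [evalAt_elem]⟩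

theorem pointIdeal_isMaximal (a b : K) (h : b ^ 2 = p.eval a) : (pointIdeal p a b h).IsMaximal :=
  RingHom.ker_isMaximal_of_surjective _ (evalAt_surjective a b h)

/-- Modulo x - a and y - b every function is congruent to the constant that is its value at the
point. -/
theorem pointIdeal_eq_span (a b : K) (h : b ^ 2 = p.eval a) :
    pointIdeal p a b h = Ideal.span {elem p (X - C a) 0, elem p (-C b) 1} := by
  apply le_antisymm
  · intro z hz
    obtain ⟨s, t, rfl⟩ := exists_elem z
    rw [mem_pointIdeal] at hz
    obtain ⟨s', hs⟩ := X_sub_C_dvd_sub_C_eval (a := a) (p := s)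
    obtain ⟨t', ht⟩ := X_sub_C_dvd_sub_C_eval (a := a) (p := t)
    rw [Ideal.mem_span_pair]
    refine ⟨elem p s' t', elem p (C (t.eval a)) 0, ?_⟩
    rw [elem_mul, elem_mul, elem_add, elem_inj]
    have h1 : C (s.eval a) = - (C b * C (t.eval a)) := by
      rw [← C_mul, ← C_neg, eq_neg_of_add_eq_zero_left hz]
    constructor
    · linear_combination (-1 : K[X]) * hs - h1
    · linear_combination (-1 : K[X]) * ht
  · rw [Ideal.span_le]
    rintro z (rfl | rfl)
    · exact mem_pointIdeal.2 (by simp)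
    · exact mem_pointIdeal.2 (by simp)

theorem pointIdeal_ne_bot (a b : K) (h : b ^ 2 = p.eval a) : pointIdeal p a b h ≠ ⊥ := by
  intro h0
  have h1 : elem p (X - C a) 0 ∈ pointIdeal p a b h := mem_pointIdeal.2 (by simp)
  rw [h0, Ideal.mem_bot] at h1
  exact X_sub_C_ne_zero a (elem_eq_zero h1).1

theorem pointIdeal_inj {a b a' b' : K} {h : b ^ 2 = p.eval a} {h' : b' ^ 2 = p.eval a'}
    (he : pointIdeal p a b h = pointIdeal p a' b' h') : a = a' ∧ b = b' := by
  have h1 : elem p (X - C a) 0 ∈ pointIdeal p a b h := mem_pointIdeal.2 (by simp)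
  have h2 : elem p (-C b) 1 ∈ pointIdeal p a b h := mem_pointIdeal.2 (by simp)
  rw [he, mem_pointIdeal] at h1 h2
  constructor
  · simp only [eval_sub, eval_X, eval_C, eval_zero, mul_zero, add_zero, sub_eq_zero] at h1
    exact h1.symm
  · simp only [eval_neg, eval_C, eval_one, mul_one] at h2
    exact neg_add_eq_zero.1 h2

/-- At a point of the double cover where `p` has no multiple zero, `(y - b) (y + b) = (x - a) c`
where `y + b` or `c` does not vanish at the point. -/
theorem exists_quotient (hp : p.Separable) (a b : K) (h : b ^ 2 = p.eval a) :
    ∃ c : K[X], p - C (b ^ 2) = (X - C a) * c ∧ (b = 0 → c.eval a ≠ 0) := by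
  obtain ⟨c, hc⟩ := X_sub_C_dvd_sub_C_eval (a := a) (p := p)
  refine ⟨c, by rw [h]; exact hc, fun hb h0 => ?_⟩
  have h1 := congrArg (fun u => eval a (derivative u)) hc
  simp only [derivative_sub, derivative_C, sub_zero, derivative_mul, derivative_X, one_mul,
    eval_add, eval_mul, eval_sub, eval_X, eval_C, sub_self, zero_mul, add_zero, h0] at h1
  have h3 : p.eval a = 0 := by rw [← h, hb]; simp
  obtain ⟨u, v, huv⟩ := hp
  have h4 := congrArg (eval a) huv
  simp [h1, h3] at h4

/-- All four products of generators are multiples of x - a. Conversely, if b ≠ 0, the two mixed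
products differ by 2b(x - a). If b = 0, then c(a) ≠ 0, so (x - a)c and (x - a)² together generate x
- a. -/
theorem pointIdeal_mul_pointIdeal (h2 : (2 : K) ≠ 0) (hp : p.Separable) (a b : K)
    (h : b ^ 2 = p.eval a) (h' : (-b) ^ 2 = p.eval a) :
    pointIdeal p a b h * pointIdeal p a (-b) h' = Ideal.span {elem p (X - C a) 0} := by
  obtain ⟨c, hc, hb0⟩ := exists_quotient hp a b h
  rw [pointIdeal_eq_span, pointIdeal_eq_span, Ideal.span_pair_mul_span_pair]
  simp only [elem_mul]
  apply le_antisymm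
  · rw [Ideal.span_le]
    rintro z (rfl | rfl | rfl | rfl) <;> rw [SetLike.mem_coe, Ideal.mem_span_singleton']
    · exact ⟨elem p (X - C a) 0, by rw [elem_mul, elem_inj]; constructor <;> ring⟩
    · exact ⟨elem p (C b) 1, by rw [elem_mul, elem_inj]; constructor <;> simp <;> ring⟩
    · exact ⟨elem p (-C b) 1, by rw [elem_mul, elem_inj]; constructor <;> simp⟩
    · refine ⟨elem p c 0, ?_⟩
      rw [elem_mul, elem_inj]
      rw [C_pow] at hc
      constructor
      · simp only [C_neg]
        linear_combination -hc
      · simp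
  · rw [Ideal.span_singleton_le_iff_mem]
    set I : Ideal (DoubleCover p) := Ideal.span _ with hI
    have hs := Ideal.span_le.1 hI.ge
    simp only [Set.insert_subset_iff, Set.singleton_subset_iff, SetLike.mem_coe] at hs
    obtain ⟨m1, m2, m3, m4⟩ := hs
    by_cases hb : b = 0
    · obtain ⟨d, hd⟩ := X_sub_C_dvd_sub_C_eval (a := a) (p := c)
      have hu : C (c.eval a)⁻¹ * C (c.eval a) = (1 : K[X]) := by
        rw [← C_mul, inv_mul_cancel₀ (hb0 hb), C_1]
      have h3 := I.mul_mem_left (elem p (C (c.eval a)⁻¹) 0)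
        (I.add_mem m4 (I.mul_mem_left (elem p (-d) 0) m1))
      convert h3 using 1
      rw [elem_mul, elem_add, elem_mul, elem_inj]
      rw [C_pow] at hc
      subst hb
      constructor
      · simp only [C_0, neg_zero] at hc ⊢
        linear_combination (-(X - C a) : K[X]) * hu - C (c.eval a)⁻¹ * hc -
          (X - C a) * C (c.eval a)⁻¹ * hd
      · simp
    · have hu : C (2 * b)⁻¹ * (2 * C b) = (1 : K[X]) := by
        rw [← C_ofNat, ← C_mul, ← C_mul, inv_mul_cancel₀ (mul_ne_zero h2 hb), C_1]
      have h3 := I.mul_mem_left (elem p (C (2 * b)⁻¹) 0)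
        (I.add_mem m2 (I.mul_mem_left (elem p (-1) 0) m3))
      convert h3 using 1
      rw [elem_mul, elem_add, elem_mul, elem_inj]
      constructor
      · simp only [C_neg]
        linear_combination (-(X - C a) : K[X]) * hu
      · simp

/-- Once u is invertible, t is a multiple of s, which alone generates. The case of interest is the
localization at a point, with s a uniformizer. -/
theorem map_span_pair_isPrincipal {R S : Type*} [CommRing R] [CommRing S] (φ : R →+* S)
    {I : Ideal R} (s t u c : R)
    (hI : I = Ideal.span {s, t}) (hu : IsUnit (φ u)) (h : t * u = s * c) :
    (I.map φ).IsPrincipal := by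
  refine ⟨φ s, ?_⟩
  rw [hI, Ideal.map_span, Set.image_pair, Ideal.submodule_span_eq]
  apply le_antisymm
  · rw [Ideal.span_le]
    rintro z (rfl | rfl)
    · exact Ideal.subset_span rfl
    · obtain ⟨v, hv⟩ := hu.exists_left_inv
      rw [SetLike.mem_coe, Ideal.mem_span_singleton']
      refine ⟨φ c * v, ?_⟩
      have h3 := congrArg φ h
      rw [map_mul, map_mul] at h3
      linear_combination (-v) * h3 + φ t * hv
  · exact Ideal.span_mono (by simp)

section Dedekind

variable [IsAlgClosed K]

/-- The norm of a nonzero element of `M` is a nonzero polynomial in `M`, and it splits, so `M`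
contains some x - a. As x - a divides (y - b)(y + b) for a square root b of p(a), `M` also contains
y - b or y + b. -/
theorem exists_eq_pointIdeal (M : Ideal (DoubleCover p)) [M.IsPrime] (hM : M ≠ ⊥) [IsDomain (DoubleCover p)] :
    ∃ (a b : K) (h : b ^ 2 = p.eval a), M = pointIdeal p a b h := by
  obtain ⟨z, hz, hz0⟩ := Submodule.exists_mem_ne_zero_of_ne_bot hM
  obtain ⟨s, t, rfl⟩ := exists_elem z
  have hN : elem p (s ^ 2 - p * t ^ 2) 0 ∈ M := by
    have e : elem p (s ^ 2 - p * t ^ 2) 0 = elem p s (-t) * elem p s t := by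
      rw [elem_mul, elem_inj]
      constructor <;> ring
    rw [e]
    exact M.mul_mem_left _ hz
  have hN0 : s ^ 2 - p * t ^ 2 ≠ 0 := by
    intro h0
    have e : elem p s (-t) * elem p s t = elem p (s ^ 2 - p * t ^ 2) 0 := by
      rw [elem_mul, elem_inj]
      constructor <;> ring
    rw [h0, elem_zero] at e
    rcases mul_eq_zero.1 e with h | h
    · refine hz0 ?_
      obtain ⟨h1, h2⟩ := elem_eq_zero h
      rw [neg_eq_zero] at h2
      rw [h1, h2, elem_zero]
    · exact hz0 h
  obtain ⟨a, ha⟩ : ∃ a : K, elem p (X - C a) 0 ∈ M := by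
    generalize s ^ 2 - p * t ^ 2 = N at hN hN0
    have hs := IsAlgClosed.splits N
    rw [hs.eq_prod_roots, elem_zero_right, map_mul] at hN
    rcases Ideal.IsPrime.mem_or_mem inferInstance hN with h | h
    · refine absurd (Ideal.eq_top_of_isUnit_mem M h ?_) (Ideal.IsPrime.ne_top inferInstance)
      exact ((isUnit_C.2 (isUnit_iff_ne_zero.2 (leadingCoeff_ne_zero.2 hN0))).map _)
    · rw [map_multiset_prod, Multiset.map_map] at h
      obtain ⟨z, hz, hzM⟩ := (Ideal.IsPrime.multiset_prod_mem_iff_exists_mem inferInstance _).1 h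
      obtain ⟨a, -, rfl⟩ := Multiset.mem_map.1 hz
      exact ⟨a, by rw [elem_zero_right]; exact hzM⟩
  obtain ⟨b, hb⟩ := IsAlgClosed.exists_pow_nat_eq (p.eval a) (n := 2) (by norm_num)
  obtain ⟨c, hc⟩ := X_sub_C_dvd_sub_C_eval (a := a) (p := p)
  have hm : elem p (-C b) 1 * elem p (-C (-b)) 1 ∈ M := by
    have e : elem p (-C b) 1 * elem p (-C (-b)) 1 = elem p c 0 * elem p (X - C a) 0 := by
      rw [elem_mul, elem_mul, elem_inj]
      rw [← hb, C_pow] at hc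
      constructor
      · simp only [C_neg]
        linear_combination hc
      · simp
    rw [e]
    exact M.mul_mem_left _ ha
  have key : ∀ b' : K, ∀ hb' : b' ^ 2 = p.eval a, elem p (-C b') 1 ∈ M → M = pointIdeal p a b' hb' := by
    intro b' hb' hm'
    refine ((pointIdeal_isMaximal a b' hb').eq_of_le (Ideal.IsPrime.ne_top inferInstance) ?_).symm
    rw [pointIdeal_eq_span, Ideal.span_le]
    rintro z (rfl | rfl)
    · exact ha
    · exact hm'
  rcases Ideal.IsPrime.mem_or_mem inferInstance hm with h | h
  · exact ⟨a, b, hb, key b hb h⟩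
  · exact ⟨a, -b, by rw [neg_sq, hb], key _ _ h⟩

theorem isDedekindDomain (h2 : (2 : K) ≠ 0) (hp : p.Separable) [IsDomain (DoubleCover p)] :
    IsDedekindDomain (DoubleCover p) := by
  have : IsDedekindDomainDvr (DoubleCover p) := by
    refine { toIsNoetherian := inferInstance, is_dvr_at_nonzero_prime := ?_ }
    intro M hM hMp
    obtain ⟨a, b, h, rfl⟩ := exists_eq_pointIdeal M hM
    set m := pointIdeal p a b h with hm
    have hnf := IsLocalization.AtPrime.not_isField (DoubleCover p) hM (Localization.AtPrime m)
    have : IsNoetherianRing (Localization.AtPrime m) :=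
      IsLocalization.isNoetherianRing m.primeCompl _ inferInstance
    -- It suffices that the maximal ideal of the local ring is principal.
    refine ((IsDiscreteValuationRing.TFAE (Localization.AtPrime m) hnf).out 0 4).2 ?_
    rw [← Localization.AtPrime.map_eq_maximalIdeal]
    obtain ⟨c, hc, hb0⟩ := exists_quotient hp a b h
    rw [C_pow] at hc
    have hunit : ∀ z, z ∉ m → IsUnit (algebraMap _ (Localization.AtPrime m) z) := fun z hz =>
      IsLocalization.map_units _ (⟨z, hz⟩ : m.primeCompl)
    have hspan := pointIdeal_eq_span a b h
    -- In (y - b)(y + b) = (x - a)c, the factor c is a local unit if b = 0 and y + b is one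
    -- otherwise. The uniformizer is y in the first case and x - a in the second.
    by_cases hb : b = 0
    · rw [Set.pair_comm] at hspan
      refine map_span_pair_isPrincipal _ _ _ (elem p c 0) (elem p (C b) 1) hspan (hunit _ ?_) ?_
      · rw [hm, mem_pointIdeal]
        simpa using hb0 hb
      · rw [elem_mul, elem_mul, elem_inj]
        constructor
        · linear_combination (-1 : K[X]) * hc
        · simp
    · refine map_span_pair_isPrincipal _ _ _ (elem p (C b) 1) (elem p c 0) hspan (hunit _ ?_) ?_
      · rw [hm, mem_pointIdeal]
        simpa [← two_mul, h2] using hb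
      · rw [elem_mul, elem_mul, elem_inj]
        constructor
        · linear_combination hc
        · simp
  infer_instance

end Dedekind

end DoubleCover

/-! ### Conjugation, Galois action, norms and units -/

namespace DoubleCover

variable {K : Type*} [Field K] {p : K[X]}

/-- The involution `(x, y) ↦ (x, -y)` on functions. -/
noncomputable def conj (p : K[X]) : DoubleCover p →+* DoubleCover p :=
  AdjoinRoot.lift (AdjoinRoot.of _) (-AdjoinRoot.root _) (by
    rw [eval₂_sub, eval₂_pow, eval₂_X, eval₂_C, neg_sq, root_sq, sub_self])

theorem conj_elem (s t : K[X]) : conj p (elem p s t) = elem p s (-t) := by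
  simp [conj, elem]

/-- The involution `(x, y) ↦ (x, -y)` on functions, as an automorphism. -/
noncomputable def conjEquiv (p : K[X]) : DoubleCover p ≃+* DoubleCover p :=
  RingEquiv.ofBijective (conj p) (by
    have h : Function.Involutive (conj p) := fun z => by
      obtain ⟨s, t, rfl⟩ := exists_elem z
      rw [conj_elem, conj_elem, neg_neg]
    exact h.bijective)

theorem conjEquiv_elem (s t : K[X]) : conjEquiv p (elem p s t) = elem p s (-t) := conj_elem s t

/-- The action on functions of an automorphism of the field of constants that fixes `p`. -/
noncomputable def twist (σ : K ≃+* K) (hσ : p.map (σ : K →+* K) = p) :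
    DoubleCover p ≃+* DoubleCover p :=
  AdjoinRoot.mapRingEquiv (Polynomial.mapEquiv σ) _ _ (by
    have h : (X ^ 2 - C p : K[X][X]).map (Polynomial.mapEquiv σ : K[X] →+* K[X]) =
        X ^ 2 - C p := by
      rw [Polynomial.map_sub, Polynomial.map_pow, map_X, map_C]
      congr 2
    exact (congrArg (fun q => Associated q (X ^ 2 - C p)) h).mpr (Associated.refl _))

theorem twist_elem (σ : K ≃+* K) (hσ : p.map (σ : K →+* K) = p) (s t : K[X]) :
    twist σ hσ (elem p s t) = elem p (s.map (σ : K →+* K)) (t.map (σ : K →+* K)) := by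
  have h1 : ∀ s : K[X], twist σ hσ (AdjoinRoot.of _ s) = AdjoinRoot.of _ (s.map (σ : K →+* K)) :=
    fun s => by simp [twist]
  have h2 : twist σ hσ (AdjoinRoot.root _) = AdjoinRoot.root _ := by simp [twist]
  rw [elem, map_add, map_mul, h1, h1, h2, elem]

theorem map_pointIdeal_eq {a b a' b' : K} {h : b ^ 2 = p.eval a} {h' : b' ^ 2 = p.eval a'}
    (e : DoubleCover p ≃+* DoubleCover p)
    (he : ∀ z, z ∈ pointIdeal p a b h ↔ e z ∈ pointIdeal p a' b' h') :
    (pointIdeal p a b h).map e = pointIdeal p a' b' h' := by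
  ext z
  rw [Ideal.mem_map_of_equiv]
  refine ⟨fun ⟨w, hw, hz⟩ => hz ▸ (he w).1 hw, fun hz => ⟨e.symm z, (he _).2 ?_, ?_⟩⟩
  · rwa [e.apply_symm_apply]
  · exact e.apply_symm_apply z

/-- The two terms have degrees of opposite parity when both are nonzero, so their leading terms
cannot cancel. -/
theorem degree_norm {p s t : K[X]} (hp : Odd p.natDegree) :
    (s ^ 2 - p * t ^ 2).degree = max (s ^ 2).degree (p * t ^ 2).degree := by
  rcases lt_trichotomy (s ^ 2).degree (p * t ^ 2).degree with h | h | h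
  · rw [degree_sub_eq_right_of_degree_lt h, max_eq_right h.le]
  · have hp0 : p ≠ 0 := by
      rintro rfl
      simp at hp
    by_cases ht : t = 0
    · simp [ht]
    · exfalso
      have hs : s ≠ 0 := by
        rintro rfl
        rw [zero_pow two_ne_zero, degree_zero, eq_comm, degree_eq_bot] at h
        exact mul_ne_zero hp0 (pow_ne_zero 2 ht) h
      have h1 := natDegree_eq_of_degree_eq h
      rw [natDegree_pow, natDegree_mul hp0 (pow_ne_zero 2 ht), natDegree_pow] at h1
      obtain ⟨m, hm⟩ := hp
      omega
  · rw [degree_sub_eq_left_of_degree_lt h, max_eq_left h.le]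

/-- The norm of a unit is a unit of K[x], of degree 0. By `degree_norm` both of its terms have
degree at most 0, which is impossible for p t² unless t = 0. -/
theorem eq_C_of_isUnit_elem (hp : Odd p.natDegree) {s t : K[X]} (h : IsUnit (elem p s t)) :
    t = 0 ∧ ∃ c : K, c ≠ 0 ∧ s = C c := by
  obtain ⟨z, hz⟩ := h.exists_right_inv
  obtain ⟨s', t', rfl⟩ := exists_elem z
  have h1 : (1 : DoubleCover p) = elem p 1 0 := by simp [elem]
  rw [elem_mul, h1, elem_inj] at hz
  have h2 : (s ^ 2 - p * t ^ 2) * (s' ^ 2 - p * t' ^ 2) = 1 := by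
    linear_combination (s * s' + p * t * t' + 1) * hz.1 - p * (s * t' + t * s') * hz.2
  have h3 : IsUnit (s ^ 2 - p * t ^ 2) := IsUnit.of_mul_eq_one _ h2
  have h4 := degree_eq_zero_of_isUnit h3
  rw [degree_norm hp] at h4
  have hp0 : p ≠ 0 := by
    rintro rfl
    simp at hp
  have ht : t = 0 := by
    by_contra ht
    have h5 : (p * t ^ 2).degree ≤ 0 := h4 ▸ le_max_right _ _
    rw [← natDegree_eq_zero_iff_degree_le_zero, natDegree_mul hp0 (pow_ne_zero 2 ht)] at h5
    obtain ⟨m, hm⟩ := hp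
    omega
  have h5 : (s ^ 2).degree ≤ 0 := h4 ▸ le_max_left _ _
  rw [← natDegree_eq_zero_iff_degree_le_zero, natDegree_pow] at h5
  have h6 : s.natDegree = 0 := by omega
  rw [natDegree_eq_zero] at h6
  obtain ⟨c, rfl⟩ := h6
  refine ⟨ht, c, ?_, rfl⟩
  rintro rfl
  simp [ht] at h2

theorem eq_C_mul_of_span_eq [IsDomain (DoubleCover p)] (hp : Odd p.natDegree) {s t s' t' : K[X]}
    (h : Ideal.span {elem p s t} = Ideal.span {elem p s' t'}) :
    ∃ c : K, c ≠ 0 ∧ s' = C c * s ∧ t' = C c * t := by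
  obtain ⟨u, hu⟩ := Ideal.span_singleton_eq_span_singleton.1 h
  obtain ⟨v, w, hvw⟩ := exists_elem (u : DoubleCover p)
  have h1 := u.isUnit
  rw [hvw] at h1 hu
  obtain ⟨rfl, c, hc, rfl⟩ := eq_C_of_isUnit_elem hp h1
  rw [elem_mul, elem_inj] at hu
  refine ⟨c, hc, ?_, ?_⟩
  · rw [← hu.1]
    ring
  · rw [← hu.2]
    ring

end DoubleCover

/-! ### Affine points as prime ideals, and zeros of functions -/

namespace HypCurve

open DoubleCover UniqueFactorizationMonoid

variable {k : Type*} [Field k] (C : HypCurve k) {K : Type*} [Field K] [Algebra k K]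

theorem algebra_two_ne_zero (C : HypCurve k) (K : Type*) [Field K] [Algebra k K] : (2 : K) ≠ 0 := by
  have h := (map_ne_zero (algebraMap k K)).2 C.two_ne_zero
  rwa [map_ofNat] at h

theorem odd_natDegree_map : Odd (C.f.map (algebraMap k K)).natDegree := by
  rw [natDegree_map, C.natDegree_eq]
  exact ⟨C.g, rfl⟩

instance [IsAlgClosed K] : IsDedekindDomain (C.CoordRing K) :=
  DoubleCover.isDedekindDomain (C.algebra_two_ne_zero K) C.separable.map

variable {C}

/-- The maximal ideal of an affine point in the coordinate ring. -/
noncomputable def AffinePoint.ideal (P : C.AffinePoint K) : Ideal (C.CoordRing K) :=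
  DoubleCover.pointIdeal _ P.x P.y (by rw [P.eqn, eval_map_algebraMap])

theorem AffinePoint.ideal_injective :
    Function.Injective (AffinePoint.ideal : C.AffinePoint K → Ideal (C.CoordRing K)) := by
  intro P Q h
  obtain ⟨h1, h2⟩ := pointIdeal_inj h
  exact AffinePoint.ext h1 h2

instance (P : C.AffinePoint K) : P.ideal.IsMaximal := pointIdeal_isMaximal _ _ _

theorem AffinePoint.ideal_ne_bot (P : C.AffinePoint K) : P.ideal ≠ ⊥ := pointIdeal_ne_bot _ _ _

theorem AffinePoint.prime_ideal [IsAlgClosed K] (P : C.AffinePoint K) : Prime P.ideal :=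
  Ideal.prime_of_isPrime P.ideal_ne_bot inferInstance

theorem exists_eq_ideal [IsAlgClosed K] {I : Ideal (C.CoordRing K)} (hI : Prime I) :
    ∃ P : C.AffinePoint K, I = P.ideal := by
  have := Ideal.isPrime_of_prime hI
  obtain ⟨a, b, h, rfl⟩ := exists_eq_pointIdeal I hI.ne_zero
  exact ⟨⟨a, b, by rw [h, eval_map_algebraMap]⟩, rfl⟩

theorem AffinePoint.ideal_mul_ideal_w (P : C.AffinePoint K) :
    P.ideal * P.w.ideal = Ideal.span {elem _ (X - Polynomial.C P.x) 0} :=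
  pointIdeal_mul_pointIdeal (C.algebra_two_ne_zero K) C.separable.map _ _ _ _

theorem AffinePoint.map_conjEquiv (P : C.AffinePoint K) :
    P.ideal.map (conjEquiv _) = P.w.ideal := by
  refine map_pointIdeal_eq _ fun z => ?_
  obtain ⟨s, t, rfl⟩ := exists_elem z
  rw [conjEquiv_elem, mem_pointIdeal, mem_pointIdeal]
  simp [AffinePoint.w]

theorem map_equation (σ : K ≃ₐ[k] K) :
    (C.f.map (algebraMap k K)).map ((σ : K ≃+* K) : K →+* K) = C.f.map (algebraMap k K) := by
  rw [Polynomial.map_map]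
  congr 1
  ext a
  simp

variable (C) in
/-- The action of an automorphism of `K` over `k` on the coordinate ring. -/
noncomputable def coordTwist (σ : K ≃ₐ[k] K) : C.CoordRing K ≃+* C.CoordRing K :=
  twist (σ : K ≃+* K) (map_equation σ)

theorem coordTwist_elem (σ : K ≃ₐ[k] K) (s t : K[X]) :
    C.coordTwist σ (elem _ s t) =
      elem _ (s.map ((σ : K ≃+* K) : K →+* K)) (t.map ((σ : K ≃+* K) : K →+* K)) :=
  twist_elem _ _ s t

theorem AffinePoint.map_coordTwist (σ : K ≃ₐ[k] K) (P : C.AffinePoint K) :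
    P.ideal.map (C.coordTwist σ) = (P.map (σ : K →ₐ[k] K)).ideal := by
  refine map_pointIdeal_eq _ fun z => ?_
  obtain ⟨s, t, rfl⟩ := exists_elem z
  rw [coordTwist_elem, mem_pointIdeal, mem_pointIdeal]
  have h : ∀ s : K[X], (s.map ((σ : K ≃+* K) : K →+* K)).eval (σ P.x) = σ (s.eval P.x) := fun s => by
    have := eval_map_apply (p := s) ((σ : K ≃+* K) : K →+* K) P.x
    simpa using this
  change _ ↔ (s.map ((σ : K ≃+* K) : K →+* K)).eval (σ P.x) +
    σ P.y * (t.map ((σ : K ≃+* K) : K →+* K)).eval (σ P.x) = 0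
  rw [h, h, ← map_mul, ← map_add]
  exact (map_eq_zero_iff σ σ.injective).symm

/-- The product of the ideals of a family of points. -/
noncomputable def idealProd (A : Multiset (C.AffinePoint K)) : Ideal (C.CoordRing K) :=
  (A.map AffinePoint.ideal).prod

theorem idealProd_map (A : Multiset (C.AffinePoint K)) (e : C.CoordRing K ≃+* C.CoordRing K)
    (f : C.AffinePoint K → C.AffinePoint K) (h : ∀ P, P.ideal.map e = (f P).ideal) :
    (idealProd A).map e = idealProd (A.map f) := by
  induction A using Multiset.induction_on with
  | empty => simp [idealProd, Ideal.map_top]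
  | cons P A ih =>
    simp only [idealProd, Multiset.map_cons, Multiset.prod_cons, Ideal.map_mul, h] at ih ⊢
    rw [ih]

theorem normalizedFactors_idealProd [IsAlgClosed K] (A : Multiset (C.AffinePoint K)) :
    normalizedFactors (idealProd A) = A.map AffinePoint.ideal := by
  refine normalizedFactors_prod_of_prime fun I hI => ?_
  obtain ⟨P, -, rfl⟩ := Multiset.mem_map.1 hI
  exact P.prime_ideal

theorem idealProd_injective [IsAlgClosed K] :
    Function.Injective (idealProd : Multiset (C.AffinePoint K) → Ideal (C.CoordRing K)) := by
  intro A B h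
  have h1 := congrArg normalizedFactors h
  rw [normalizedFactors_idealProd, normalizedFactors_idealProd] at h1
  exact Multiset.map_injective AffinePoint.ideal_injective h1

theorem idealProd_ne_zero [IsAlgClosed K] (A : Multiset (C.AffinePoint K)) : idealProd A ≠ 0 := by
  refine Multiset.prod_ne_zero fun h => ?_
  obtain ⟨P, -, hP⟩ := Multiset.mem_map.1 h
  exact P.ideal_ne_bot hP

/-- The norm to `K[x]` of a function with zeros `A`. -/
theorem norm_eq_prod {A : Multiset (C.AffinePoint K)} {s t : K[X]}
    (h : Ideal.span {elem (C.f.map (algebraMap k K)) s t} = idealProd A) :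
    ∃ c : K, c ≠ 0 ∧ s ^ 2 - C.f.map (algebraMap k K) * t ^ 2 =
      Polynomial.C c * (A.map fun Q => X - Polynomial.C Q.x).prod := by
  have h1 := congrArg (Ideal.map (conjEquiv (C.f.map (algebraMap k K)))) h
  rw [idealProd_map A _ _ AffinePoint.map_conjEquiv, Ideal.map_span, Set.image_singleton,
    conjEquiv_elem] at h1
  -- The conjugate function vanishes on the image of `A` under w, and each pair P, w(P) contributes
  -- the factor x - x(P).
  have h2 : Ideal.span {elem (C.f.map (algebraMap k K)) s t} *
      Ideal.span {elem (C.f.map (algebraMap k K)) s (-t)} =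
      Ideal.span {elem (C.f.map (algebraMap k K)) (A.map fun Q => X - Polynomial.C Q.x).prod 0} := by
    rw [h, h1]
    clear h h1
    induction A using Multiset.induction_on with
    | empty =>
      have : elem (C.f.map (algebraMap k K)) 1 0 = 1 := by simp [elem]
      simp [idealProd, this]
    | cons P A ih =>
      simp only [idealProd, Multiset.map_cons, Multiset.prod_cons] at ih ⊢
      rw [mul_mul_mul_comm, ih, AffinePoint.ideal_mul_ideal_w,
        Ideal.span_singleton_mul_span_singleton, elem_mul]
      congr 3 <;> ring
  rw [Ideal.span_singleton_mul_span_singleton, elem_mul] at h2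
  obtain ⟨c, hc, h3, -⟩ := eq_C_mul_of_span_eq C.odd_natDegree_map h2.symm
  refine ⟨c, hc, ?_⟩
  rw [← h3]
  ring

section Orders

variable [IsAlgClosed K]

open Classical in
theorem count_of_hasOrder {P : C.AffinePoint K}
    {a : C.CoordRing K} {i : ℕ} (h : HasOrder P.ideal a i) :
    a ≠ 0 ∧ (normalizedFactors (Ideal.span {a})).count P.ideal = i := by
  have h1 := Ideal.count_normalizedFactors_eq (p := P.ideal) (x := Ideal.span {a}) (n := i)
    ((Ideal.span_singleton_le_iff_mem _).2 h.1)
    (fun hle => h.2 ((Ideal.span_singleton_le_iff_mem _).1 hle))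
  refine ⟨?_, by convert h1⟩
  rintro rfl
  exact h.2 (Ideal.zero_mem _)

/-- Write h = a₀ / b₀. Comparing multiplicities at every prime gives (a₀) = (b₀) · `idealProd A`, so
b₀ divides a₀ and the quotient generates `idealProd A`. -/
theorem exists_eq_algebraMap_of_hasOrderAt [DecidableEq (C.AffinePoint K)] {h : C.FunctionField K}
    {A : Multiset (C.AffinePoint K)} (hA : ∀ P, HasOrderAt h (some P) (A.count P))
    (h0 : h ≠ 0) :
    ∃ s t : K[X], h = algebraMap _ (C.FunctionField K) (elem (C.f.map (algebraMap k K)) s t) ∧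
      Ideal.span {elem (C.f.map (algebraMap k K)) s t} = idealProd A := by
  classical
  have hinj := IsFractionRing.injective (C.CoordRing K) (C.FunctionField K)
  obtain ⟨a₀, b₀, hb, rfl⟩ := IsFractionRing.div_surjective (A := C.CoordRing K) h
  have hb₀ : b₀ ≠ 0 := nonZeroDivisors.ne_zero hb
  have hb₁ : algebraMap (C.CoordRing K) (C.FunctionField K) b₀ ≠ 0 :=
    (map_ne_zero_iff _ hinj).2 hb₀
  have ha₀ : a₀ ≠ 0 := by
    rintro rfl
    simp at h0
  have hspan : ∀ {z : C.CoordRing K}, z ≠ 0 → (Ideal.span {z} : Ideal (C.CoordRing K)) ≠ 0 :=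
    fun hz => by simpa using hz
  have key : Ideal.span {a₀} = Ideal.span {b₀} * idealProd A := by
    have hcount : normalizedFactors (Ideal.span {a₀}) =
        normalizedFactors (Ideal.span {b₀} * idealProd A) := by
      ext I
      by_cases hI : Prime I
      · obtain ⟨P, rfl⟩ := exists_eq_ideal hI
        obtain ⟨a, b, i, j, hi, hj, hab, hij⟩ := hA P
        obtain ⟨ha, hi⟩ := count_of_hasOrder hi
        obtain ⟨hb, hj⟩ := count_of_hasOrder hj
        -- The order at P is witnessed by a fraction a / b depending on P; cross-multiplication
        -- transfers it to the fixed fraction.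
        have h1 : a₀ * b = a * b₀ := by
          apply hinj
          rw [map_mul, map_mul, ← hab]
          field_simp
        have h2 := congrArg (fun z => (normalizedFactors (Ideal.span {z})).count P.ideal) h1
        simp only [← Ideal.span_singleton_mul_span_singleton] at h2
        rw [normalizedFactors_mul (hspan ha₀) (hspan hb), normalizedFactors_mul (hspan ha)
          (hspan hb₀), Multiset.count_add, Multiset.count_add, hi, hj] at h2
        rw [normalizedFactors_mul (hspan hb₀) (idealProd_ne_zero A), Multiset.count_add,
          normalizedFactors_idealProd, Multiset.count_map_eq_count' _ _ AffinePoint.ideal_injective]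
        omega
      · rw [Multiset.count_eq_zero_of_notMem fun h => hI (prime_of_normalized_factor _ h),
          Multiset.count_eq_zero_of_notMem fun h => hI (prime_of_normalized_factor _ h)]
    rw [← Ideal.prod_normalizedFactors_eq_self (hspan ha₀), hcount,
      Ideal.prod_normalizedFactors_eq_self (mul_ne_zero (hspan hb₀) (idealProd_ne_zero A))]
  have hdvd : a₀ ∈ Ideal.span {b₀} := by
    rw [← Ideal.span_singleton_le_iff_mem, key]
    exact Ideal.mul_le_left
  obtain ⟨c, rfl⟩ := Ideal.mem_span_singleton'.1 hdvd
  obtain ⟨s, t, rfl⟩ := exists_elem c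
  refine ⟨s, t, ?_, ?_⟩
  · rw [map_mul, mul_div_assoc, div_self hb₁, mul_one]
  · rw [mul_comm, ← Ideal.span_singleton_mul_span_singleton] at key
    exact mul_left_cancel₀ (hspan hb₀) key

end Orders

end HypCurve

/-! ### Descent of functions to the finite base field -/

theorem FiniteField.exists_algebraMap_eq_of_pow_card (F : Type*) {K : Type*} [Field F] [Fintype F]
    [Field K] [Algebra F K] {x : K} (h : x ^ Fintype.card F = x) :
    ∃ c : F, algebraMap F K c = x := by
  classical
  have h0 := FiniteField.X_pow_card_sub_X_ne_zero K (Fintype.one_lt_card (α := F))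
  have hd := FiniteField.X_pow_card_sub_X_natDegree_eq K (Fintype.one_lt_card (α := F))
  have hsub : Finset.univ.image (algebraMap F K) ⊆
      (X ^ Fintype.card F - X : K[X]).roots.toFinset := by
    intro y hy
    obtain ⟨c, -, rfl⟩ := Finset.mem_image.1 hy
    rw [Multiset.mem_toFinset, mem_roots h0, IsRoot.def]
    simp [← map_pow, FiniteField.pow_card]
  have heq := Finset.eq_of_subset_of_card_le hsub (by
    rw [Finset.card_image_of_injective _ (algebraMap F K).injective, Finset.card_univ]
    exact (Multiset.toFinset_card_le _).trans ((card_roots' _).trans hd.le))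
  have hx : x ∈ (X ^ Fintype.card F - X : K[X]).roots.toFinset := by
    rw [Multiset.mem_toFinset, mem_roots h0, IsRoot.def]
    simp [h]
  rw [← heq] at hx
  obtain ⟨c, -, hc⟩ := Finset.mem_image.1 hx
  exact ⟨c, hc⟩

theorem FiniteField.exists_map_eq_of_coeff_pow_card (F : Type*) {K : Type*} [Field F] [Fintype F]
    [Field K] [Algebra F K] {s : K[X]} (h : ∀ i, s.coeff i ^ Fintype.card F = s.coeff i) :
    ∃ s' : F[X], s'.map (algebraMap F K) = s :=
  (mem_lifts s).1 ((lifts_iff_coeff_lifts s).2 fun i =>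
    FiniteField.exists_algebraMap_eq_of_pow_card F (h i))

theorem HasFracOrder.unit_mul {R F : Type*} [CommRing R] [CommRing F] {ψ : R →+* F} {m : Ideal R}
    {h : F} {d : ℤ} (hh : HasFracOrder ψ m h d) {u : R} (hu : IsUnit u) :
    HasFracOrder ψ m (ψ u * h) d := by
  obtain ⟨a, b, i, j, ha, hb, hab, hd⟩ := hh
  refine ⟨u * a, b, i, j, ⟨?_, ?_⟩, hb, ?_, hd⟩
  · exact Ideal.mul_mem_left _ _ ha.1
  · rw [Ideal.unit_mul_mem_iff_mem _ hu]
    exact ha.2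
  · rw [mul_assoc, hab, map_mul]

namespace HypCurve

open DoubleCover

variable {k : Type*} [Field k] {C : HypCurve k} {K : Type*} [Field K] [Algebra k K]

theorem algebraMap_elem (s t : K[X]) :
    algebraMap (C.CoordRing K) (C.FunctionField K) (elem _ s t) =
      aeval (C.xFun K) s + C.yFun K * aeval (C.xFun K) t := by
  rw [elem, map_add, map_mul, algebraMap_of, algebraMap_of, yFun]

theorem HasDivisor.const_mul {h : C.FunctionField K} {D : C.Divisor K} (hD : HasDivisor h D)
    {c : K} (hc : c ≠ 0) : HasDivisor (algebraMap K (C.FunctionField K) c * h) D := by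
  have hu : ∀ p : K[X], IsUnit (AdjoinRoot.of (X ^ 2 - Polynomial.C p : K[X][X]) (Polynomial.C c)) :=
    fun p => (isUnit_C.2 hc.isUnit).map _
  rintro (_ | P)
  · have h1 : algebraMap K (C.FunctionField K) c = C.infEmb K (AdjoinRoot.of _ (Polynomial.C c)) := by
      rw [infEmb, AdjoinRoot.lift_of, RingHom.coe_coe, aeval_C]
    rw [h1]
    exact (hD none).unit_mul (hu _)
  · have h1 : algebraMap K (C.FunctionField K) c =
        algebraMap (C.CoordRing K) (C.FunctionField K) (AdjoinRoot.of _ (Polynomial.C c)) := by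
      rw [algebraMap_of, aeval_C]
    rw [h1]
    exact (hD (some P)).unit_mul (hu _)

instance [IsAlgClosed K] : Nonempty (C.AffinePoint K) := by
  obtain ⟨b, hb⟩ := IsAlgClosed.exists_pow_nat_eq (aeval (0 : K) C.f) (n := 2) (by norm_num)
  exact ⟨⟨0, b, hb⟩⟩

/-- The numerator must lie outside some power of the ideal. Since affine points exist, a function
with a prescribed divisor is therefore automatically nonzero. -/
theorem ne_zero_of_hasOrderAt {h : C.FunctionField K} {P : C.AffinePoint K} {d : ℤ}
    (hh : HasOrderAt h (some P) d) : h ≠ 0 := by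
  rintro rfl
  obtain ⟨a, b, i, j, ha, hb, hab, hd⟩ := hh
  rw [zero_mul, eq_comm, map_eq_zero_iff _ (IsFractionRing.injective _ _)] at hab
  rw [hab] at ha
  exact ha.2 (Ideal.zero_mem _)

variable (C) in
/-- The action of an automorphism of `K` over `k` on the function field. -/
noncomputable def functionTwist (σ : K ≃ₐ[k] K) : C.FunctionField K ≃+* C.FunctionField K :=
  IsFractionRing.ringEquivOfRingEquiv (C.coordTwist σ)

theorem functionTwist_algebraMap (σ : K ≃ₐ[k] K) (z : C.CoordRing K) :
    C.functionTwist σ (algebraMap _ _ z) = algebraMap _ _ (C.coordTwist σ z) :=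
  IsFractionRing.ringEquivOfRingEquiv_algebraMap _ _

theorem functionTwist_eq_self (σ : K ≃ₐ[k] K) {h : C.FunctionField K}
    (hh : h ∈ C.baseFunctionField K) : C.functionTwist σ h = h := by
  induction hh using IntermediateField.adjoin_induction with
  | mem z hz =>
    rcases hz with rfl | rfl
    · have h1 : C.xFun K = algebraMap _ _ (elem (C.f.map (algebraMap k K)) X 0) := by
        rw [algebraMap_elem]
        simp
      rw [h1, functionTwist_algebraMap, coordTwist_elem]
      simp
    · have h1 : C.yFun K = algebraMap _ _ (elem (C.f.map (algebraMap k K)) 0 1) := by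
        rw [algebraMap_elem]
        simp
      rw [h1, functionTwist_algebraMap, coordTwist_elem]
      simp
  | algebraMap c =>
    have h1 : algebraMap k (C.FunctionField K) c = algebraMap _ _
        (elem (C.f.map (algebraMap k K)) (Polynomial.C (algebraMap k K c)) 0) := by
      rw [algebraMap_elem, map_zero, mul_zero, add_zero, aeval_C,
        ← IsScalarTower.algebraMap_apply]
    rw [h1, functionTwist_algebraMap, coordTwist_elem]
    simp
  | add x y _ _ hx hy => rw [map_add, hx, hy]
  | inv x _ hx => rw [map_inv₀, hx]
  | mul x y _ _ hx hy => rw [map_mul, hx, hy]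

theorem map_eq_self_of_mem_base (σ : K ≃ₐ[k] K) {s t : K[X]}
    (h : algebraMap (C.CoordRing K) (C.FunctionField K) (elem _ s t) ∈ C.baseFunctionField K) :
    s.map ((σ : K ≃+* K) : K →+* K) = s ∧ t.map ((σ : K ≃+* K) : K →+* K) = t := by
  have h1 := functionTwist_eq_self σ h
  rw [functionTwist_algebraMap] at h1
  have h2 := IsFractionRing.injective (C.CoordRing K) (C.FunctionField K) h1
  rwa [coordTwist_elem, elem_inj] at h2

theorem aeval_add_mul_aeval (h₁ h₂ : k[X]) :
    aeval (C.xFun K) h₁ + C.yFun K * aeval (C.xFun K) h₂ =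
      algebraMap (C.CoordRing K) (C.FunctionField K)
        (elem _ (h₁.map (algebraMap k K)) (h₂.map (algebraMap k K))) := by
  rw [algebraMap_elem, aeval_map_algebraMap, aeval_map_algebraMap]

theorem aeval_add_mul_aeval_mem (h₁ h₂ : k[X]) :
    aeval (C.xFun K) h₁ + C.yFun K * aeval (C.xFun K) h₂ ∈ C.baseFunctionField K := by
  have hx : C.xFun K ∈ C.baseFunctionField K :=
    IntermediateField.subset_adjoin _ _ (Set.mem_insert _ _)
  have hy : C.yFun K ∈ C.baseFunctionField K :=
    IntermediateField.subset_adjoin _ _ (Set.mem_insert_of_mem _ rfl)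
  have ha : ∀ q : k[X], aeval (C.xFun K) q ∈ C.baseFunctionField K := fun q =>
    Algebra.adjoin_le (S := (C.baseFunctionField K).toSubalgebra)
      (Set.singleton_subset_iff.2 hx) (aeval_mem_adjoin_singleton k _)
  exact add_mem (ha _) (mul_mem hy (ha _))

/-- The zeros of a function are determined by the function. -/
theorem eq_of_hasOrderAt [IsAlgClosed K] [DecidableEq (C.AffinePoint K)] {h : C.FunctionField K}
    {A B : Multiset (C.AffinePoint K)}
    (hA : ∀ P, HasOrderAt h (some P) (A.count P)) (hB : ∀ P, HasOrderAt h (some P) (B.count P)) :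
    A = B := by
  have h0 := ne_zero_of_hasOrderAt (hA (Classical.arbitrary _))
  obtain ⟨s, t, rfl, hst⟩ := exists_eq_algebraMap_of_hasOrderAt hA h0
  obtain ⟨s', t', e, hst'⟩ := exists_eq_algebraMap_of_hasOrderAt hB h0
  have h1 := IsFractionRing.injective (C.CoordRing K) (C.FunctionField K) e
  rw [elem_inj] at h1
  obtain ⟨rfl, rfl⟩ := h1
  exact idealProd_injective (hst.symm.trans hst')

section Frobenius

variable [Fintype k] [Algebra.IsAlgebraic k K]

theorem map_frobenius_eq_self_iff {s : K[X]} :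
    s.map (((FiniteField.frobeniusAlgEquivOfAlgebraic k K : K ≃ₐ[k] K) : K ≃+* K) : K →+* K) = s ↔
      ∀ i, s.coeff i ^ Fintype.card k = s.coeff i := by
  rw [Polynomial.ext_iff]
  simp

/-- Elements of k(x, y) are fixed by the Frobenius action on coefficients, and the solutions of z^q
= z are the elements of `k`. -/
theorem exists_polynomials_of_mem_base {s t : K[X]}
    (h : algebraMap (C.CoordRing K) (C.FunctionField K) (elem _ s t) ∈ C.baseFunctionField K) :
    ∃ h₁ h₂ : k[X], s = h₁.map (algebraMap k K) ∧ t = h₂.map (algebraMap k K) := by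
  obtain ⟨hs, ht⟩ := map_eq_self_of_mem_base (FiniteField.frobeniusAlgEquivOfAlgebraic k K) h
  rw [map_frobenius_eq_self_iff] at hs ht
  obtain ⟨h₁, e₁⟩ := FiniteField.exists_map_eq_of_coeff_pow_card k hs
  obtain ⟨h₂, e₂⟩ := FiniteField.exists_map_eq_of_coeff_pow_card k ht
  exact ⟨h₁, h₂, e₁.symm, e₂.symm⟩

variable [IsAlgClosed K] [DecidableEq (C.AffinePoint K)]

/-- A function over `k` without poles in the affine plane is a polynomial in `x` and `y`. -/
theorem exists_polynomials_of_hasOrderAt {h : C.FunctionField K} (hb : h ∈ C.baseFunctionField K)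
    {A : Multiset (C.AffinePoint K)} (hA : ∀ P, HasOrderAt h (some P) (A.count P)) :
    ∃ h₁ h₂ : k[X], h = aeval (C.xFun K) h₁ + C.yFun K * aeval (C.xFun K) h₂ ∧
      Ideal.span {elem (C.f.map (algebraMap k K)) (h₁.map (algebraMap k K))
        (h₂.map (algebraMap k K))} = idealProd A := by
  obtain ⟨s, t, rfl, hst⟩ := exists_eq_algebraMap_of_hasOrderAt hA
    (ne_zero_of_hasOrderAt (hA (Classical.arbitrary _)))
  obtain ⟨h₁, h₂, rfl, rfl⟩ := exists_polynomials_of_mem_base hb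
  exact ⟨h₁, h₂, (aeval_add_mul_aeval h₁ h₂).symm, hst⟩

theorem eq_const_mul_of_hasOrderAt {h h' : C.FunctionField K} (hb : h ∈ C.baseFunctionField K)
    (hb' : h' ∈ C.baseFunctionField K) {A : Multiset (C.AffinePoint K)}
    (hA : ∀ P, HasOrderAt h (some P) (A.count P)) (hA' : ∀ P, HasOrderAt h' (some P) (A.count P)) :
    ∃ c : k, c ≠ 0 ∧ h' = algebraMap k (C.FunctionField K) c * h := by
  obtain ⟨h₁, h₂, rfl, hs⟩ := exists_polynomials_of_hasOrderAt hb hA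
  obtain ⟨h₁', h₂', rfl, hs'⟩ := exists_polynomials_of_hasOrderAt hb' hA'
  obtain ⟨c, hc, e₁, e₂⟩ := eq_C_mul_of_span_eq C.odd_natDegree_map (hs.trans hs'.symm)
  have hinj : Function.Injective (Polynomial.map (algebraMap k K)) :=
    Polynomial.map_injective _ (algebraMap k K).injective
  -- The constant is a priori in `K`, but it is a ratio of coefficients of polynomials over `k`.
  have hrat : ∃ d : k, algebraMap k K d = c := by
    have key : ∀ u v : k[X], v.map (algebraMap k K) = Polynomial.C c * u.map (algebraMap k K) →
        u ≠ 0 → ∃ d : k, algebraMap k K d = c := by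
      intro u v huv hu
      refine ⟨v.coeff u.natDegree / u.leadingCoeff, ?_⟩
      have h1 := congrArg (fun q => coeff q u.natDegree) huv
      simp only [coeff_map, coeff_C_mul] at h1
      rw [map_div₀, h1, leadingCoeff, mul_div_cancel_right₀]
      exact (_root_.map_ne_zero _).2 (leadingCoeff_ne_zero.2 hu)
    by_cases hu : h₁ = 0
    · by_cases hv : h₂ = 0
      · refine absurd ?_ (ne_zero_of_hasOrderAt (hA (Classical.arbitrary _)))
        simp [hu, hv]
      · exact key _ _ e₂ hv
    · exact key _ _ e₁ hu
  obtain ⟨d, rfl⟩ := hrat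
  refine ⟨d, fun hd => hc (by rw [hd, map_zero]), ?_⟩
  have e₁' : h₁' = Polynomial.C d * h₁ := hinj (by rw [e₁, Polynomial.map_mul, map_C])
  have e₂' : h₂' = Polynomial.C d * h₂ := hinj (by rw [e₂, Polynomial.map_mul, map_C])
  rw [e₁', e₂', map_mul, map_mul, aeval_C]
  ring

/-- A function whose divisor is invariant under Frobenius has a constant multiple over `k`. -/
theorem exists_const_mul_mem_base {h : C.FunctionField K} {A : Multiset (C.AffinePoint K)}
    (hA : ∀ P, HasOrderAt h (some P) (A.count P))
    (hinv : A.map (AffinePoint.map (FiniteField.frobeniusAlgHom k K)) = A) :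
    ∃ c : K, c ≠ 0 ∧ algebraMap K (C.FunctionField K) c * h ∈ C.baseFunctionField K := by
  have h0 := ne_zero_of_hasOrderAt (hA (Classical.arbitrary _))
  obtain ⟨s, t, rfl, hst⟩ := exists_eq_algebraMap_of_hasOrderAt hA h0
  set σ := FiniteField.frobeniusAlgEquivOfAlgebraic k K with hσ
  have hσ' : (σ : K →ₐ[k] K) = FiniteField.frobeniusAlgHom k K := by
    ext z
    rfl
  have h1 := congrArg (Ideal.map (C.coordTwist σ)) hst
  rw [idealProd_map A _ _ (AffinePoint.map_coordTwist σ), hσ', hinv, Ideal.map_span,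
    Set.image_singleton, coordTwist_elem, ← hst] at h1
  obtain ⟨c, hc, e₁, e₂⟩ := eq_C_mul_of_span_eq C.odd_natDegree_map h1.symm
  have hco : ∀ u : K[X], u.map ((σ : K ≃+* K) : K →+* K) = Polynomial.C c * u →
      ∀ i, u.coeff i ^ Fintype.card k = c * u.coeff i := by
    intro u hu i
    have h2 := congrArg (fun q => coeff q i) hu
    rw [coeff_map, coeff_C_mul] at h2
    exact h2
  -- An explicit form of Hilbert 90: every coefficient of s and t satisfies z^q = c z, so a nonzero
  -- one serves as l, and the coefficients divided by l are fixed by Frobenius.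
  have hl : ∃ l : K, l ≠ 0 ∧ l ^ Fintype.card k = c * l := by
    by_cases hs : s = 0
    · refine ⟨t.leadingCoeff, leadingCoeff_ne_zero.2 fun ht => h0 ?_, hco t e₂ _⟩
      rw [hs, ht, elem_zero, map_zero]
    · exact ⟨s.leadingCoeff, leadingCoeff_ne_zero.2 hs, hco s e₁ _⟩
  obtain ⟨l, hl0, hl⟩ := hl
  have hfix : ∀ u : K[X], u.map ((σ : K ≃+* K) : K →+* K) = Polynomial.C c * u →
      ∃ u' : k[X], u'.map (algebraMap k K) = Polynomial.C l⁻¹ * u := by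
    intro u hu
    refine FiniteField.exists_map_eq_of_coeff_pow_card k fun i => ?_
    rw [coeff_C_mul, mul_pow, hco u hu, inv_pow, hl]
    field_simp
  obtain ⟨h₁, e₁'⟩ := hfix s e₁
  obtain ⟨h₂, e₂'⟩ := hfix t e₂
  refine ⟨l⁻¹, inv_ne_zero hl0, ?_⟩
  have h3 := aeval_add_mul_aeval_mem (C := C) (K := K) h₁ h₂
  rw [aeval_add_mul_aeval, e₁', e₂', algebraMap_elem, map_mul, map_mul, aeval_C] at h3
  rw [algebraMap_elem]
  convert h3 using 1
  ring

end Frobenius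

end HypCurve

/-! ### Orbits and traces of finite multisets under an injective map -/

section Orbits

open Function

variable {α : Type*}

/-- The orbit of `Q` under a self-map `g`, listed along one period. -/
noncomputable def orbitMultiset (g : α → α) (Q : α) : Multiset α :=
  Finset.univ.val.map fun i : Fin (minimalPeriod g Q) => g^[(i : ℕ)] Q

/-- The sum of the images of a family under the first `n` iterates of `f`. -/
def traceMultiset (f : α → α) (n : ℕ) (A : Multiset α) : Multiset α :=
  ∑ j ∈ Finset.range n, A.map f^[j]

theorem card_orbitMultiset (g : α → α) (Q : α) :
    (orbitMultiset g Q).card = minimalPeriod g Q := by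
  simp [orbitMultiset]

theorem iterate_fin_injective (g : α → α) (Q : α) :
    Injective fun i : Fin (minimalPeriod g Q) => g^[(i : ℕ)] Q := fun i j h =>
  Fin.ext (iterate_injOn_Iio_minimalPeriod i.2 j.2 h)

theorem nodup_orbitMultiset (g : α → α) (Q : α) : (orbitMultiset g Q).Nodup :=
  Finset.univ.nodup.map (iterate_fin_injective g Q)

theorem mem_orbitMultiset {g : α → α} {Q R : α} (hQ : Q ∈ periodicPts g) :
    R ∈ orbitMultiset g Q ↔ ∃ i : ℕ, g^[i] Q = R := by
  rw [orbitMultiset, Multiset.mem_map]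
  constructor
  · rintro ⟨i, -, rfl⟩
    exact ⟨i, rfl⟩
  · rintro ⟨i, rfl⟩
    exact ⟨⟨i % minimalPeriod g Q, Nat.mod_lt _ (minimalPeriod_pos_of_mem_periodicPts hQ)⟩,
      Finset.mem_univ_val _, iterate_mod_minimalPeriod_eq⟩

theorem self_mem_orbitMultiset {g : α → α} {Q : α} (hQ : Q ∈ periodicPts g) :
    Q ∈ orbitMultiset g Q := (mem_orbitMultiset hQ).2 ⟨0, rfl⟩

theorem map_orbitMultiset_of_commute {f g : α → α} (hf : Injective f) (h : Function.Commute f g)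
    (hp : ∀ Q, Q ∈ periodicPts g) (Q : α) :
    (orbitMultiset g Q).map f = orbitMultiset g (f Q) := by
  refine (Multiset.Nodup.ext ((nodup_orbitMultiset g Q).map hf) (nodup_orbitMultiset g _)).2
    fun R => ?_
  rw [Multiset.mem_map, mem_orbitMultiset (hp _)]
  constructor
  · rintro ⟨S, hS, rfl⟩
    obtain ⟨i, rfl⟩ := (mem_orbitMultiset (hp _)).1 hS
    exact ⟨i, ((h.iterate_right i) Q).symm⟩
  · rintro ⟨i, rfl⟩
    exact ⟨g^[i] Q, (mem_orbitMultiset (hp _)).2 ⟨i, rfl⟩, (h.iterate_right i) Q⟩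

theorem map_orbitMultiset {g : α → α} (hg : Injective g) (hp : ∀ Q, Q ∈ periodicPts g) (Q : α) :
    (orbitMultiset g Q).map g = orbitMultiset g Q := by
  refine (Multiset.eq_of_le_of_card_le ?_ (by rw [Multiset.card_map]))
  refine (Multiset.le_iff_subset ((nodup_orbitMultiset g Q).map hg)).2 fun R hR => ?_
  obtain ⟨S, hS, rfl⟩ := Multiset.mem_map.1 hR
  obtain ⟨i, rfl⟩ := (mem_orbitMultiset (hp _)).1 hS
  exact (mem_orbitMultiset (hp _)).2 ⟨i + 1, iterate_succ_apply' g i Q⟩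

/-- An orbit has no repetitions, so containment reduces to membership, which the invariance of `A`
propagates. -/
theorem orbitMultiset_le {g : α → α} (hp : ∀ Q, Q ∈ periodicPts g) {A : Multiset α}
    (hA : A.map g = A) {Q : α} (hQ : Q ∈ A) : orbitMultiset g Q ≤ A := by
  refine (Multiset.le_iff_subset (nodup_orbitMultiset g Q)).2 fun R hR => ?_
  obtain ⟨i, rfl⟩ := (mem_orbitMultiset (hp _)).1 hR
  clear hR
  induction i with
  | zero => exact hQ
  | succ i ih =>
    rw [iterate_succ_apply', ← hA]
    exact Multiset.mem_map_of_mem g ih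

/-- Removing the orbit of one point leaves a smaller invariant multiset. -/
theorem exists_eq_sum_orbitMultiset {g : α → α} (hg : Injective g)
    (hp : ∀ Q, Q ∈ periodicPts g) (A : Multiset α) (hA : A.map g = A) :
    ∃ (t : ℕ) (Q : Fin t → α), (∀ i, Q i ∈ A) ∧ A = ∑ i, orbitMultiset g (Q i) := by
  classical
  induction hc : A.card using Nat.strong_induction_on generalizing A with
  | _ c ih =>
    rcases A.empty_or_exists_mem with rfl | ⟨R, hR⟩
    · exact ⟨0, Fin.elim0, fun i => i.elim0, by simp⟩
    · obtain ⟨B, rfl⟩ := Multiset.le_iff_exists_add.1 (orbitMultiset_le hp hA hR)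
      rw [Multiset.map_add, map_orbitMultiset hg hp, add_right_inj] at hA
      have hpos := minimalPeriod_pos_of_mem_periodicPts (hp R)
      rw [Multiset.card_add, card_orbitMultiset] at hc
      obtain ⟨t, Q, hQ, e⟩ := ih B.card (by omega) B hA rfl
      refine ⟨t + 1, Fin.cons R Q, fun i => ?_, ?_⟩
      · refine Fin.cases hR (fun i => ?_) i
        exact Multiset.mem_add.2 (Or.inr (hQ i))
      · rw [Fin.sum_univ_succ]
        simp only [Fin.cons_zero, Fin.cons_succ]
        rw [← e]

theorem traceMultiset_add (f : α → α) (n : ℕ) (A B : Multiset α) :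
    traceMultiset f n (A + B) = traceMultiset f n A + traceMultiset f n B := by
  simp [traceMultiset, Finset.sum_add_distrib]

theorem card_traceMultiset (f : α → α) (n : ℕ) (A : Multiset α) :
    (traceMultiset f n A).card = n * A.card := by
  simp [traceMultiset]

theorem map_traceMultiset (f : α → α) (n : ℕ) (A : Multiset α) :
    (traceMultiset f n A).map f = traceMultiset f n (A.map f) := by
  rw [traceMultiset, ← Multiset.coe_mapAddMonoidHom, map_sum]
  refine Finset.sum_congr rfl fun j _ => ?_
  rw [Multiset.coe_mapAddMonoidHom, Multiset.map_map, Multiset.map_map, ← iterate_succ',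
    ← iterate_succ]

/-- Both sides are the sum of the images under the iterates 0, …, n, with the first or the last term
split off. -/
theorem traceMultiset_map_add (f : α → α) (n : ℕ) (A : Multiset α) :
    traceMultiset f n (A.map f) + A = traceMultiset f n A + A.map f^[n] := by
  have h := (Finset.sum_range_succ (fun j => A.map f^[j]) n).symm.trans
    (Finset.sum_range_succ' (fun j => A.map f^[j]) n)
  rw [traceMultiset, traceMultiset, h]
  simp [Multiset.map_map, iterate_succ]

theorem traceMultiset_map {f : α → α} {n : ℕ} {A : Multiset α} (hA : A.map f^[n] = A) :
    traceMultiset f n (A.map f) = traceMultiset f n A := by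
  have h := traceMultiset_map_add f n A
  rwa [hA, add_left_inj] at h

theorem traceMultiset_map_iterate {f : α → α} {n : ℕ} {A : Multiset α} (hA : A.map f^[n] = A)
    (j : ℕ) : traceMultiset f n (A.map f^[j]) = traceMultiset f n A := by
  induction j with
  | zero => simp
  | succ j ih =>
    rw [iterate_succ', ← Multiset.map_map, traceMultiset_map, ih]
    rw [Multiset.map_map, ← iterate_add, add_comm, iterate_add, ← Multiset.map_map, hA]

/-- Invariance of `A` under the n-th iterate makes the common trace f-invariant, and the telescoping
identity for `B` then cancels to the claim. This is why F need not be assumed rational in (iv). -/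
theorem map_iterate_eq_of_traceMultiset_eq {f : α → α} {n : ℕ} {A B : Multiset α}
    (h : traceMultiset f n B = traceMultiset f n A) (hA : A.map f^[n] = A) :
    B.map f^[n] = B := by
  have h1 := traceMultiset_map_add f n B
  rw [← map_traceMultiset, h, map_traceMultiset, traceMultiset_map hA, add_right_inj] at h1
  exact h1.symm

theorem le_traceMultiset {f : α → α} {n : ℕ} (hn : 0 < n) (A : Multiset α) :
    A ≤ traceMultiset f n A := by
  obtain ⟨m, rfl⟩ := Nat.exists_eq_succ_of_ne_zero hn.ne'
  rw [traceMultiset, Finset.sum_range_succ']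
  simp

/-- An invariant family with the same trace as a sum of orbits is a sum of translates of these
orbits. -/
theorem exists_eq_sum_map_iterate {f : α → α} (hf : Injective f) {n : ℕ} (hn : 0 < n)
    (hp : ∀ Q, Q ∈ periodicPts f^[n]) (t : ℕ) (E : Fin t → Multiset α)
    (hE : ∀ i, ∃ Q, E i = orbitMultiset f^[n] Q) (F : Multiset α) (hF : F.map f^[n] = F)
    (h : traceMultiset f n F = traceMultiset f n (∑ i, E i)) :
    ∃ j : Fin t → Fin n, F = ∑ i, (E i).map f^[(j i : ℕ)] := by
  induction t generalizing F with
  | zero =>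
    refine ⟨Fin.elim0, ?_⟩
    have h1 := le_traceMultiset (f := f) hn F
    rw [h] at h1
    simpa [traceMultiset] using h1
  | succ t ih =>
    obtain ⟨Q, hQ⟩ := hE 0
    have hfn : Injective f^[n] := hf.iterate n
    have hinv : (E 0).map f^[n] = E 0 := by rw [hQ, map_orbitMultiset hfn hp]
    have hcomm : ∀ b : ℕ, Function.Commute f^[b] f^[n] := fun b =>
      (Function.Commute.iterate_iterate_self f b n)
    obtain ⟨b, hb⟩ : ∃ b : Fin n, f^[(b : ℕ)] Q ∈ F := by
      have h1 : Q ∈ traceMultiset f n F := by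
        rw [h]
        refine Multiset.mem_of_le (le_traceMultiset hn _) ?_
        rw [Fin.sum_univ_succ]
        exact Multiset.mem_add.2 (Or.inl (hQ ▸ self_mem_orbitMultiset (hp Q)))
      obtain ⟨a, ha, haQ⟩ := Multiset.mem_sum.1 h1
      rw [Finset.mem_range] at ha
      obtain ⟨R, hR, rfl⟩ := Multiset.mem_map.1 haQ
      -- From Q = f^a(R) with R in F, the translate f^(n-a)(Q) = f^n(R) lies in F. The case a = 0 is
      -- separate because the exponent must be less than n.
      rcases Nat.eq_zero_or_pos a with rfl | ha0
      · exact ⟨⟨0, hn⟩, hR⟩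
      · refine ⟨⟨n - a, by omega⟩, ?_⟩
        rw [← iterate_add_apply, Nat.sub_add_cancel ha.le, ← hF]
        exact Multiset.mem_map_of_mem _ hR
    have hle : (E 0).map f^[(b : ℕ)] ≤ F := by
      rw [hQ, map_orbitMultiset_of_commute (hf.iterate b) (hcomm b) hp]
      exact orbitMultiset_le hp hF hb
    -- The translated orbit has the same trace as the orbit itself, so both can be cancelled and the
    -- induction applies to the rest.
    obtain ⟨G, rfl⟩ := Multiset.le_iff_exists_add.1 hle
    have hinv' : ((E 0).map f^[(b : ℕ)]).map f^[n] = (E 0).map f^[(b : ℕ)] := by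
      rw [Multiset.map_map, (hcomm b).comp_eq.symm, ← Multiset.map_map, hinv]
    rw [Multiset.map_add, hinv', add_right_inj] at hF
    rw [Fin.sum_univ_succ, traceMultiset_add, traceMultiset_add, traceMultiset_map_iterate hinv,
      add_right_inj] at h
    obtain ⟨j, hj⟩ := ih (fun i => E i.succ) (fun i => hE _) G hF h
    refine ⟨Fin.cons b j, ?_⟩
    rw [Fin.sum_univ_succ]
    simp only [Fin.cons_zero, Fin.cons_succ]
    rw [← hj]

end Orbits

/-! ### Divisors as multisets of points; prime divisors as Frobenius orbits -/

namespace HypCurve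

open Function

variable {k : Type*} [Field k] {C : HypCurve k} {K : Type*} [Field K] [Algebra k K]

variable (C K) in
/-- The divisor `P₁ + … + Pᵣ - r O` of a multiset of affine points. -/
noncomputable def affineDivisor : Multiset (C.AffinePoint K) →+ C.Divisor K :=
  Multiset.sumAddMonoidHom.comp (Multiset.mapAddMonoidHom fun P =>
    Finsupp.single (some P) (1 : ℤ) - Finsupp.single none (1 : ℤ))

theorem affineDivisor_singleton (P : C.AffinePoint K) :
    C.affineDivisor K {P} = Finsupp.single (some P) (1 : ℤ) - Finsupp.single none (1 : ℤ) := by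
  simp [affineDivisor]

theorem affineDivisor_cons (P : C.AffinePoint K) (A : Multiset (C.AffinePoint K)) :
    C.affineDivisor K (P ::ₘ A) =
      Finsupp.single (some P) (1 : ℤ) - Finsupp.single none (1 : ℤ) + C.affineDivisor K A := by
  rw [← Multiset.singleton_add, map_add, affineDivisor_singleton]

theorem affineDivisor_some [DecidableEq (C.AffinePoint K)] (A : Multiset (C.AffinePoint K))
    (P : C.AffinePoint K) : C.affineDivisor K A (some P) = A.count P := by
  induction A using Multiset.induction_on with
  | empty => simp
  | cons Q A ih =>
    rw [affineDivisor_cons, Finsupp.add_apply, ih, Multiset.count_cons]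
    by_cases h : P = Q
    · simp [h, add_comm]
    · simp [h]

/-- The affine coefficients are the multiplicities. Identities between such divisors thus become
identities of multisets. -/
theorem affineDivisor_injective : Injective (C.affineDivisor K) := by
  classical
  intro A B h
  ext P
  have h1 := DFunLike.congr_fun h (some P)
  rw [affineDivisor_some, affineDivisor_some] at h1
  exact_mod_cast h1

/-- The multiset of the points of a family. -/
def pointsOf {r : ℕ} (P : Fin r → C.AffinePoint K) : Multiset (C.AffinePoint K) :=
  Finset.univ.val.map P

theorem card_pointsOf {r : ℕ} (P : Fin r → C.AffinePoint K) : (pointsOf P).card = r := by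
  simp [pointsOf]

theorem mem_pointsOf {r : ℕ} {P : Fin r → C.AffinePoint K} {Q : C.AffinePoint K} :
    Q ∈ pointsOf P ↔ ∃ i, P i = Q := by
  simp [pointsOf]

theorem divisorOf_eq_affineDivisor {r : ℕ} (P : Fin r → C.AffinePoint K) :
    divisorOf P = C.affineDivisor K (pointsOf P) := by
  have h : pointsOf P = ∑ i, {P i} := by
    have h1 := Multiset.sum_map_singleton (Finset.univ.val.map P)
    rw [Multiset.map_map] at h1
    exact h1.symm
  rw [h, map_sum]
  simp only [affineDivisor_singleton, Finset.sum_sub_distrib, divisorOf]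
  simp

theorem map_affineDivisor (σ : K →ₐ[k] K) (A : Multiset (C.AffinePoint K)) :
    (C.affineDivisor K A).map σ = C.affineDivisor K (A.map (AffinePoint.map σ)) := by
  induction A using Multiset.induction_on with
  | empty => simp [Divisor.map]
  | cons Q A ih =>
    rw [Multiset.map_cons, affineDivisor_cons, affineDivisor_cons, ← ih, Divisor.map, Divisor.map,
      Finsupp.mapDomain_add, sub_eq_add_neg, sub_eq_add_neg, Finsupp.mapDomain_add,
      ← Finsupp.single_neg, Finsupp.mapDomain_single, Finsupp.mapDomain_single]
    rfl

/-- The polynomial `∏ (x - x(P))` of a multiset of points. -/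
noncomputable def xPoly (A : Multiset (C.AffinePoint K)) : K[X] :=
  (A.map fun P => X - Polynomial.C P.x).prod

theorem mumfordU_eq_xPoly {r : ℕ} (P : Fin r → C.AffinePoint K) :
    mumfordU P = xPoly (pointsOf P) := by
  rw [mumfordU, xPoly, pointsOf, Multiset.map_map]
  rfl

theorem monic_xPoly (A : Multiset (C.AffinePoint K)) : (xPoly A).Monic :=
  monic_multiset_prod_of_monic _ _ fun P _ => monic_X_sub_C P.x

theorem natDegree_xPoly (A : Multiset (C.AffinePoint K)) : (xPoly A).natDegree = A.card := by
  have h := natDegree_multiset_prod_X_sub_C_eq_card (A.map AffinePoint.x)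
  rwa [Multiset.map_map, Multiset.card_map] at h

theorem xPoly_add (A B : Multiset (C.AffinePoint K)) : xPoly (A + B) = xPoly A * xPoly B := by
  simp [xPoly]

theorem xPoly_dvd {A B : Multiset (C.AffinePoint K)} (h : A ≤ B) : xPoly A ∣ xPoly B :=
  Multiset.prod_dvd_prod_of_le (Multiset.map_le_map h)

theorem eval_xPoly_eq_zero_iff (A : Multiset (C.AffinePoint K)) (a : K) :
    (xPoly A).eval a = 0 ↔ ∃ P ∈ A, a = P.x := by
  rw [xPoly, eval_multiset_prod, Multiset.prod_eq_zero_iff]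
  simp [sub_eq_zero]

theorem map_xPoly (σ : K →ₐ[k] K) (A : Multiset (C.AffinePoint K)) :
    (xPoly A).map (σ : K →+* K) = xPoly (A.map (AffinePoint.map σ)) := by
  rw [xPoly, Polynomial.map_multiset_prod, Multiset.map_map, xPoly, Multiset.map_map]
  congr 1
  refine Multiset.map_congr rfl fun P _ => ?_
  simp [AffinePoint.map]

theorem AffinePoint.map_injective (σ : K →ₐ[k] K) :
    Injective (AffinePoint.map σ : C.AffinePoint K → C.AffinePoint K) := by
  intro P Q h
  have h1 := congrArg AffinePoint.x h
  have h2 := congrArg AffinePoint.y h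
  exact AffinePoint.ext ((σ : K →+* K).injective h1) ((σ : K →+* K).injective h2)

theorem AffinePoint.map_pow (σ : K →ₐ[k] K) (j : ℕ) :
    (AffinePoint.map (σ ^ j) : C.AffinePoint K → C.AffinePoint K) = (AffinePoint.map σ)^[j] := by
  induction j with
  | zero => rfl
  | succ j ih =>
    rw [iterate_succ', ← ih]
    funext P
    rw [pow_succ']
    rfl

theorem AffinePoint.eq_or_eq_w {P Q : C.AffinePoint K} (h : P.x = Q.x) : P = Q ∨ P = Q.w := by
  have h1 : P.y ^ 2 = Q.y ^ 2 := by rw [P.eqn, Q.eqn, h]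
  rcases sq_eq_sq_iff_eq_or_eq_neg.1 h1 with h2 | h2
  · exact Or.inl (AffinePoint.ext h h2)
  · exact Or.inr (AffinePoint.ext h h2)

theorem HasDivisor.count_eq [DecidableEq (C.AffinePoint K)] {h : C.FunctionField K}
    {A : Multiset (C.AffinePoint K)} (hD : HasDivisor h (C.affineDivisor K A))
    (P : C.AffinePoint K) : HasOrderAt h (some P) (A.count P) := by
  rw [← affineDivisor_some]
  exact hD (some P)

theorem IsReduced.exists_affineDivisor {F : C.Divisor K} (hF : IsReduced F) :
    ∃ B, F = C.affineDivisor K B := by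
  obtain ⟨r, P, -, rfl⟩ := hF
  exact ⟨_, divisorOf_eq_affineDivisor P⟩

section Frobenius

variable [Fintype k]

variable (C K) in
/-- The `q`-Frobenius on affine points. -/
def frobPoint : C.AffinePoint K → C.AffinePoint K :=
  AffinePoint.map (FiniteField.frobeniusAlgHom k K)

theorem frobPoint_injective : Injective (C.frobPoint K) := AffinePoint.map_injective _

theorem frob_affineDivisor (j : ℕ) (A : Multiset (C.AffinePoint K)) :
    frob j (C.affineDivisor K A) = C.affineDivisor K (A.map (C.frobPoint K)^[j]) := by
  rw [frob, map_affineDivisor, AffinePoint.map_pow, frobPoint]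

theorem isRational_affineDivisor {n : ℕ} {A : Multiset (C.AffinePoint K)} :
    IsRational n (C.affineDivisor K A) ↔ A.map (C.frobPoint K)^[n] = A := by
  rw [IsRational, frob_affineDivisor, affineDivisor_injective.eq_iff]

theorem trace_affineDivisor (n : ℕ) (A : Multiset (C.AffinePoint K)) :
    trace n (C.affineDivisor K A) = C.affineDivisor K (traceMultiset (C.frobPoint K) n A) := by
  simp only [trace, traceMultiset, map_sum, frob_affineDivisor]

theorem frobPoint_iterate_x (j : ℕ) (P : C.AffinePoint K) :
    ((C.frobPoint K)^[j] P).x = P.x ^ Fintype.card k ^ j := by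
  induction j generalizing P with
  | zero => simp
  | succ j ih =>
    rw [iterate_succ_apply, ih, pow_succ', pow_mul]
    rfl

theorem frobPoint_iterate_y (j : ℕ) (P : C.AffinePoint K) :
    ((C.frobPoint K)^[j] P).y = P.y ^ Fintype.card k ^ j := by
  induction j generalizing P with
  | zero => simp
  | succ j ih =>
    rw [iterate_succ_apply, ih, pow_succ', pow_mul]
    rfl

/-- The coordinates generate a finite field of some degree m over `k`, on which the m-th power of
Frobenius is the identity. -/
theorem mem_periodicPts_frobPoint [Algebra.IsAlgebraic k K] (P : C.AffinePoint K) :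
    P ∈ periodicPts (C.frobPoint K) := by
  let M := IntermediateField.adjoin k {P.x, P.y}
  have : FiniteDimensional k M := IntermediateField.finiteDimensional_adjoin fun z _ =>
    Algebra.IsIntegral.isIntegral z
  have : Finite M := Module.finite_of_finite k
  let _ : Fintype M := Fintype.ofFinite M
  have hcard : Fintype.card M = Fintype.card k ^ Module.finrank k M :=
    Module.card_eq_pow_finrank
  have hfix : ∀ z ∈ M, z ^ Fintype.card k ^ Module.finrank k M = z := by
    intro z hz
    have h := FiniteField.pow_card (⟨z, hz⟩ : M)
    rw [hcard] at h
    exact congrArg Subtype.val h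
  refine ⟨Module.finrank k M, Module.finrank_pos, AffinePoint.ext ?_ ?_⟩
  · rw [frobPoint_iterate_x]
    exact hfix _ (IntermediateField.subset_adjoin _ _ (Set.mem_insert _ _))
  · rw [frobPoint_iterate_y]
    exact hfix _ (IntermediateField.subset_adjoin _ _ (Set.mem_insert_of_mem _ rfl))

theorem mem_periodicPts_frobPoint_iterate [Algebra.IsAlgebraic k K] {n : ℕ}
    (P : C.AffinePoint K) : P ∈ periodicPts (C.frobPoint K)^[n] := by
  obtain ⟨m, hm, h⟩ := mem_periodicPts_frobPoint P
  exact ⟨m, hm, by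
    rw [IsPeriodicPt, ← iterate_mul]
    exact h.const_mul n⟩

theorem frobNorm_xPoly (n : ℕ) (A : Multiset (C.AffinePoint K)) :
    frobNorm k n (xPoly A) = xPoly (traceMultiset (C.frobPoint K) n A) := by
  rw [frobNorm, traceMultiset]
  induction n with
  | zero => simp [xPoly]
  | succ n ih =>
    rw [Finset.prod_range_succ, Finset.sum_range_succ, xPoly_add, ih, map_xPoly,
      AffinePoint.map_pow, frobPoint]

section Subfield

variable {L : Type*} [Field L] [Fintype L] [Algebra L K] {n : ℕ}

theorem exists_map_eq_xPoly (hL : Fintype.card L = Fintype.card k ^ n)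
    {A : Multiset (C.AffinePoint K)} (hA : A.map (C.frobPoint K)^[n] = A) :
    ∃ u : L[X], u.map (algebraMap L K) = xPoly A := by
  refine FiniteField.exists_map_eq_of_coeff_pow_card L fun i => ?_
  have h := map_xPoly (FiniteField.frobeniusAlgHom k K ^ n) A
  rw [AffinePoint.map_pow] at h
  change _ = xPoly (A.map (C.frobPoint K)^[n]) at h
  rw [hA] at h
  have h1 := congrArg (fun q => coeff q i) h
  rw [coeff_map] at h1
  have h2 : ∀ (j : ℕ) (z : K), (FiniteField.frobeniusAlgHom k K ^ j) z = z ^ Fintype.card k ^ j := by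
    intro j z
    induction j with
    | zero => simp
    | succ j ih =>
      rw [pow_succ', AlgHom.mul_apply, ih, pow_succ, pow_mul]
      rfl
  rw [hL, ← h2]
  exact h1

/-- The orbit of a point of a reduced divisor is a prime divisor. -/
theorem isPrimeDivisor_orbit [Algebra.IsAlgebraic k K] [Algebra.IsAlgebraic L K]
    (hL : Fintype.card L = Fintype.card k ^ n)
    {r : ℕ} {P : Fin r → C.AffinePoint K} (hP : IsReducedFamily P)
    (hA : (pointsOf P).map (C.frobPoint K)^[n] = pointsOf P) {Q : C.AffinePoint K}
    (hQ : Q ∈ pointsOf P) :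
    IsPrimeDivisor n L (C.affineDivisor K (orbitMultiset (C.frobPoint K)^[n] Q)) := by
  have hg : Injective (C.frobPoint K)^[n] := frobPoint_injective.iterate n
  have hp := mem_periodicPts_frobPoint_iterate (C := C) (K := K) (n := n)
  have hle := orbitMultiset_le hp hA hQ
  have hinv := map_orbitMultiset hg hp Q
  set O := orbitMultiset (C.frobPoint K)^[n] Q with hO
  have hcard : O.card = minimalPeriod (C.frobPoint K)^[n] Q := card_orbitMultiset _ _
  -- Reducedness speaks of indices; distinct points have distinct indices. A Weierstrass point,
  -- equal to its own w-image, is not excluded.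
  have hne : ∀ R ∈ O, ∀ S ∈ O, R ≠ S → R ≠ S.w := by
    intro R hR S hS hRS
    obtain ⟨i, rfl⟩ := mem_pointsOf.1 (Multiset.mem_of_le hle hR)
    obtain ⟨j, rfl⟩ := mem_pointsOf.1 (Multiset.mem_of_le hle hS)
    exact hP.2 i j fun h => hRS (by rw [h])
  have hmem : ∀ i : Fin (minimalPeriod (C.frobPoint K)^[n] Q),
      ((C.frobPoint K)^[n])^[(i : ℕ)] Q ∈ O := fun i => (mem_orbitMultiset (hp Q)).2 ⟨i, rfl⟩
  refine ⟨isRational_affineDivisor.2 hinv, _,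
    fun i : Fin (minimalPeriod (C.frobPoint K)^[n] Q) => ((C.frobPoint K)^[n])^[(i : ℕ)] Q,
    ⟨?_, fun i j hij => ?_⟩, ?_, ?_⟩
  · rw [← hcard]
    refine (Multiset.card_le_card hle).trans ?_
    rw [card_pointsOf]
    exact hP.1
  · exact hne _ (hmem i) _ (hmem j) ((iterate_fin_injective _ Q).ne hij)
  · rw [divisorOf_eq_affineDivisor]
    rfl
  rw [mumfordU_eq_xPoly]
  change ∃ u : L[X], Irreducible u ∧ u.map (algebraMap L K) = xPoly O
  obtain ⟨u, hu⟩ := exists_map_eq_xPoly hL hinv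
  refine ⟨u, ?_, hu⟩
  have hint : IsIntegral L Q.x := Algebra.IsIntegral.isIntegral _
  have hmon : u.Monic := by
    have h := monic_xPoly O
    rw [← hu] at h
    exact monic_of_injective (algebraMap L K).injective h
  have hdvd : minpoly L Q.x ∣ u := by
    refine minpoly.dvd _ _ ?_
    rw [← eval_map_algebraMap, hu, eval_xPoly_eq_zero_iff]
    exact ⟨Q, self_mem_orbitMultiset (hp Q), rfl⟩
  -- A polynomial over `L` has roots stable under the |L|-th power map, which is φⁿ on
  -- x-coordinates.
  have hroot : ∀ i : ℕ, aeval (((C.frobPoint K)^[n])^[i] Q).x (minpoly L Q.x) = 0 := by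
    intro i
    induction i with
    | zero => exact minpoly.aeval _ _
    | succ i ih =>
      rw [iterate_succ_apply', frobPoint_iterate_x, ← hL]
      have h := aeval_algHom_apply (FiniteField.frobeniusAlgHom L K)
        (((C.frobPoint K)^[n])^[i] Q).x (minpoly L Q.x)
      rw [ih, map_zero] at h
      exact h
  have hdeg : u.natDegree ≤ (minpoly L Q.x).natDegree := by
    classical
    have hux : u.natDegree = O.card := by
      rw [← natDegree_xPoly, ← hu, natDegree_map]
    have h0 : (minpoly L Q.x).map (algebraMap L K) ≠ 0 :=
      Polynomial.map_ne_zero (minpoly.ne_zero hint)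
    -- Points with equal x are equal or exchanged by w, and reducedness rules out the latter. The
    -- minimal polynomial of x(Q) thus has at least as many roots as the degree of u, so u equals
    -- it.
    have hnd : (O.map AffinePoint.x).Nodup := by
      refine Multiset.Nodup.map_on (fun R hR S hS h => ?_) (nodup_orbitMultiset _ _)
      by_contra hRS
      rcases AffinePoint.eq_or_eq_w h with h1 | h1
      · exact hRS h1
      · exact hne R hR S hS hRS h1
    have hsub : O.map AffinePoint.x ≤ ((minpoly L Q.x).map (algebraMap L K)).roots := by
      refine (Multiset.le_iff_subset hnd).2 fun a ha => ?_
      obtain ⟨R, hR, rfl⟩ := Multiset.mem_map.1 ha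
      obtain ⟨i, rfl⟩ := (mem_orbitMultiset (hp Q)).1 hR
      rw [mem_roots h0, IsRoot.def, eval_map_algebraMap]
      exact hroot i
    have h1 := (Multiset.card_le_card hsub).trans (card_roots' _)
    rwa [Multiset.card_map, natDegree_map, ← hux] at h1
  have := eq_of_monic_of_dvd_of_natDegree_le (minpoly.monic hint) hmon hdvd hdeg
  rw [this]
  exact minpoly.irreducible hint

/-- A prime divisor is the orbit of a point. -/
theorem IsPrimeDivisor.exists_orbit [Algebra.IsAlgebraic k K]
    (hL : Fintype.card L = Fintype.card k ^ n) {E : C.Divisor K} (hE : IsPrimeDivisor n L E) :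
    ∃ Q, E = C.affineDivisor K (orbitMultiset (C.frobPoint K)^[n] Q) := by
  obtain ⟨hrat, r, P, hP, rfl, u, hu, huP⟩ := hE
  have hg : Injective (C.frobPoint K)^[n] := frobPoint_injective.iterate n
  have hp := mem_periodicPts_frobPoint_iterate (C := C) (K := K) (n := n)
  rw [divisorOf_eq_affineDivisor] at hrat ⊢
  rw [isRational_affineDivisor] at hrat
  rw [mumfordU_eq_xPoly] at huP
  have hdu : u.natDegree = (pointsOf P).card := by
    rw [← natDegree_xPoly, ← huP, natDegree_map]
  have hr : 0 < (pointsOf P).card := hdu ▸ hu.natDegree_pos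
  obtain ⟨Q, hQ⟩ := Multiset.card_pos_iff_exists_mem.1 hr
  have hle := orbitMultiset_le hp hrat hQ
  obtain ⟨v, hv⟩ := exists_map_eq_xPoly hL (map_orbitMultiset hg hp Q)
  have hdv : v.natDegree = (orbitMultiset (C.frobPoint K)^[n] Q).card := by
    rw [← natDegree_xPoly, ← hv, natDegree_map]
  -- The orbit of one point of the divisor gives a nonconstant factor over `L` of the irreducible u;
  -- equality of degrees leaves no further points.
  have hdvd : v ∣ u := by
    rw [← map_dvd_map' (algebraMap L K), hv, huP]
    exact xPoly_dvd hle
  have hpos : 0 < v.natDegree := by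
    rw [hdv, card_orbitMultiset]
    exact minimalPeriod_pos_of_mem_periodicPts (hp Q)
  have hnu : ¬ IsUnit v := fun h => hpos.ne' (natDegree_eq_zero_of_isUnit h)
  have hass : Associated v u := (hu.dvd_iff.1 hdvd).resolve_left hnu |>.symm
  have hdeg := natDegree_eq_of_degree_eq (degree_eq_degree_of_associated hass)
  exact ⟨Q, congrArg _ (Multiset.eq_of_le_of_card_le hle (by omega)).symm⟩

end Subfield

end Frobenius

end HypCurve

/-! ### Degree bounds, divisors with equal trace, and the main theorem -/

theorem DoubleCover.natDegree_of_degree_norm_eq {k : Type*} [Field k] {p s t : k[X]} {g m : ℕ}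
    (hp : p.natDegree = 2 * g + 1) (h : (s ^ 2 - p * t ^ 2).degree = (m : ℕ)) :
    (s ≠ 0 → 2 * s.natDegree ≤ m) ∧ (t ≠ 0 → 2 * g + 1 + 2 * t.natDegree ≤ m) ∧
      (Even m → s ≠ 0 ∧ 2 * s.natDegree = m) ∧
      (Odd m → t ≠ 0 ∧ 2 * g + 1 + 2 * t.natDegree = m) := by
  have hodd : Odd p.natDegree := ⟨g, hp⟩
  have hp0 : p ≠ 0 := by
    rintro rfl
    simp at hp
  rw [degree_norm hodd] at h
  have hs : s ≠ 0 → (s ^ 2).degree = (2 * s.natDegree : ℕ) := fun hs => by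
    rw [degree_eq_natDegree (pow_ne_zero 2 hs), natDegree_pow]
  have ht : t ≠ 0 → (p * t ^ 2).degree = (2 * g + 1 + 2 * t.natDegree : ℕ) := fun ht => by
    rw [degree_eq_natDegree (mul_ne_zero hp0 (pow_ne_zero 2 ht)),
      natDegree_mul hp0 (pow_ne_zero 2 ht), natDegree_pow, hp]
  have hs0 : (s ^ 2).degree = (m : ℕ) → s ≠ 0 := by
    rintro h1 rfl
    simp at h1
  have ht0 : (p * t ^ 2).degree = (m : ℕ) → t ≠ 0 := by
    rintro h1 rfl
    simp at h1
  refine ⟨fun h0 => ?_, fun h0 => ?_, fun hm => ?_, fun hm => ?_⟩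
  · have h1 : (s ^ 2).degree ≤ (m : ℕ) := h ▸ le_max_left _ _
    rw [hs h0] at h1
    exact_mod_cast h1
  · have h1 : (p * t ^ 2).degree ≤ (m : ℕ) := h ▸ le_max_right _ _
    rw [ht h0] at h1
    exact_mod_cast h1
  · rcases max_choice (s ^ 2).degree (p * t ^ 2).degree with h1 | h1 <;> rw [h1] at h
    · refine ⟨hs0 h, ?_⟩
      rw [hs (hs0 h)] at h
      exact_mod_cast h
    · rw [ht (ht0 h)] at h
      have h2 : 2 * g + 1 + 2 * t.natDegree = m := by exact_mod_cast h
      obtain ⟨a, ha⟩ := hm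
      omega
  · rcases max_choice (s ^ 2).degree (p * t ^ 2).degree with h1 | h1 <;> rw [h1] at h
    · rw [hs (hs0 h)] at h
      have h2 : 2 * s.natDegree = m := by exact_mod_cast h
      obtain ⟨a, ha⟩ := hm
      omega
    · refine ⟨ht0 h, ?_⟩
      rw [ht (ht0 h)] at h
      exact_mod_cast h

namespace HypCurve

open Function DoubleCover

variable {k : Type*} [Field k] [Fintype k] {C : HypCurve k} {K : Type*} [Field K] [Algebra k K]
  {n : ℕ}

theorem exists_prime_decomposition {L : Type*} [Field L] [Fintype L] [Algebra L K]
    [Algebra.IsAlgebraic k K] [Algebra.IsAlgebraic L K]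
    (hL : Fintype.card L = Fintype.card k ^ n) {r : ℕ} {P : Fin r → C.AffinePoint K}
    (hP : IsReducedFamily P) (hA : (pointsOf P).map (C.frobPoint K)^[n] = pointsOf P) :
    ∃ (t : ℕ) (E : Fin t → C.Divisor K), (∀ i, IsPrimeDivisor n L (E i)) ∧
      C.affineDivisor K (pointsOf P) = ∑ i, E i := by
  obtain ⟨t, Q, hQ, e⟩ := exists_eq_sum_orbitMultiset (frobPoint_injective.iterate n)
    mem_periodicPts_frobPoint_iterate (pointsOf P) hA
  refine ⟨t, fun i => C.affineDivisor K (orbitMultiset (C.frobPoint K)^[n] (Q i)),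
    fun i => isPrimeDivisor_orbit hL hP hA (hQ i), ?_⟩
  conv_lhs => rw [e]
  rw [map_sum]

/-- The reduced divisors with the same trace as a sum of prime divisors. -/
theorem trace_eq_iff_exists_frob {L : Type*} [Field L] [Fintype L] [Algebra L K]
    [Algebra.IsAlgebraic k K] (hn : 0 < n)
    (hL : Fintype.card L = Fintype.card k ^ n) {A : Multiset (C.AffinePoint K)}
    (hA : A.map (C.frobPoint K)^[n] = A) {t : ℕ} {E : Fin t → C.Divisor K}
    (hE : ∀ i, IsPrimeDivisor n L (E i)) (hAE : C.affineDivisor K A = ∑ i, E i)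
    (F : Multiset (C.AffinePoint K)) :
    traceMultiset (C.frobPoint K) n F = traceMultiset (C.frobPoint K) n A ↔
      ∃ j : Fin t → Fin n, C.affineDivisor K F = ∑ i, frob (j i : ℕ) (E i) := by
  have hinj := frobPoint_injective (C := C) (K := K)
  have hp := mem_periodicPts_frobPoint_iterate (C := C) (K := K) (n := n)
  choose Q hQ using fun i => (hE i).exists_orbit hL
  set O : Fin t → Multiset (C.AffinePoint K) := fun i => orbitMultiset (C.frobPoint K)^[n] (Q i)
    with hO
  have hOinv : ∀ i, (O i).map (C.frobPoint K)^[n] = O i := fun i =>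
    map_orbitMultiset (hinj.iterate n) hp _
  have hAO : A = ∑ i, O i := by
    apply affineDivisor_injective
    rw [hAE, map_sum]
    exact Finset.sum_congr rfl fun i _ => hQ i
  have hsum : ∀ j : Fin t → Fin n, C.affineDivisor K F = ∑ i, frob (j i : ℕ) (E i) ↔
      F = ∑ i, (O i).map (C.frobPoint K)^[(j i : ℕ)] := by
    intro j
    rw [← affineDivisor_injective.eq_iff, map_sum]
    refine Eq.congr_right (Finset.sum_congr rfl fun i _ => ?_)
    rw [hQ i, frob_affineDivisor]
  simp only [hsum]
  constructor
  · intro h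
    refine exists_eq_sum_map_iterate hinj hn hp t O (fun i => ⟨Q i, rfl⟩) F
      (map_iterate_eq_of_traceMultiset_eq h hA) ?_
    rw [h, hAO]
  -- Each orbit is φⁿ-stable, so applying a power of φ only permutes the summands of its trace.
  · rintro ⟨j, rfl⟩
    rw [hAO]
    clear hAO hAE hsum hE hQ hO
    induction t with
    | zero => simp
    | succ t ih =>
      rw [Fin.sum_univ_succ, Fin.sum_univ_succ, traceMultiset_add, traceMultiset_add,
        traceMultiset_map_iterate (hOinv 0)]
      congr 1
      exact ih (E := fun i => E i.succ) (fun i => Q i.succ) (fun i => hOinv _)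
        (fun i => j i.succ)

theorem length_le_of_prime_decomposition {L : Type*} [Field L] [Fintype L] [Algebra L K]
    [Algebra.IsAlgebraic k K] (hL : Fintype.card L = Fintype.card k ^ n)
    {A : Multiset (C.AffinePoint K)} {t : ℕ} {E : Fin t → C.Divisor K}
    (hE : ∀ i, IsPrimeDivisor n L (E i)) (hAE : C.affineDivisor K A = ∑ i, E i) :
    t ≤ A.card := by
  have hp := mem_periodicPts_frobPoint_iterate (C := C) (K := K) (n := n)
  choose Q hQ using fun i => (hE i).exists_orbit hL
  have hAO : A = ∑ i, orbitMultiset (C.frobPoint K)^[n] (Q i) := by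
    apply affineDivisor_injective
    rw [hAE, map_sum]
    exact Finset.sum_congr rfl fun i _ => hQ i
  rw [hAO, Multiset.card_sum]
  calc t = ∑ _i : Fin t, 1 := by simp
    _ ≤ _ := Finset.sum_le_sum fun i _ => by
      rw [card_orbitMultiset]
      exact minimalPeriod_pos_of_mem_periodicPts (hp _)

end HypCurve

open HypCurve Function in
theorem mainTheorem1
    {k : Type*} [Field k] [Fintype k] (C : HypCurve k)
    {K : Type*} [Field K] [Algebra k K] [IsAlgClosure k K]
    {L : Type*} [Field L] [Algebra k L] [Algebra L K] [IsScalarTower k L K]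
    (n : ℕ) (hn : n.Prime) (hL : Module.finrank k L = n)
    (r : ℕ) (P : Fin r → C.AffinePoint K) (hP : HypCurve.IsReducedFamily P)
    (D : C.Divisor K) (hD : D = HypCurve.divisorOf P)
    (hT : HypCurve.IsTraceZero n D) :
    -- the decomposition into prime divisors over `L` exists
    (∃ (t : ℕ) (E : Fin t → C.Divisor K),
      (∀ i, HypCurve.IsPrimeDivisor n L (E i)) ∧ D = ∑ i, E i) ∧
    -- a function over `k` with divisor `Tr(D)` exists
    (∃ h ∈ C.baseFunctionField K, HypCurve.HasDivisor h (HypCurve.trace n D)) ∧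
    ∀ h ∈ C.baseFunctionField K, HypCurve.HasDivisor h (HypCurve.trace n D) →
      -- and it is unique up to constants
      (∀ h' ∈ C.baseFunctionField K, HypCurve.HasDivisor h' (HypCurve.trace n D) →
        ∃ c : k, c ≠ 0 ∧ h' = algebraMap k (C.FunctionField K) c * h) ∧
      (∃ h₁ h₂ : k[X],
        h = aeval (C.xFun K) h₁ + C.yFun K * aeval (C.xFun K) h₂ ∧
        (h₁ ^ 2 - C.f * h₂ ^ 2).degree = (r * n : ℕ) ∧
        (∀ a : K, aeval a (h₁ ^ 2 - C.f * h₂ ^ 2) = 0 ↔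
          ∃ (i : Fin r) (j : Fin n),
            a = ((P i).map (FiniteField.frobeniusAlgHom k K ^ (j : ℕ))).x) ∧
        (∃ c : k, c ≠ 0 ∧ (h₁ ^ 2 - C.f * h₂ ^ 2).map (algebraMap k K) =
          Polynomial.C (algebraMap k K c) * frobNorm k n (HypCurve.mumfordU P)) ∧
        (h₁ ≠ 0 → (h₁.natDegree : ℤ) ≤ ⌊(n * r : ℚ) / 2⌋) ∧
        (h₂ ≠ 0 → (h₂.natDegree : ℤ) ≤ ⌊(n * r - 2 * C.g - 1 : ℚ) / 2⌋) ∧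
        (Even r ∨ n = 2 → h₁ ≠ 0 ∧ (h₁.natDegree : ℤ) = ⌊(n * r : ℚ) / 2⌋) ∧
        (Odd r → n ≠ 2 → h₂ ≠ 0 ∧
          (h₂.natDegree : ℤ) = ⌊(n * r - 2 * C.g - 1 : ℚ) / 2⌋)) ∧
      (∀ (t : ℕ) (E : Fin t → C.Divisor K),
        (∀ i, HypCurve.IsPrimeDivisor n L (E i)) → D = ∑ i, E i →
        ∀ F : C.Divisor K, HypCurve.IsReduced F →
          ((∃ h' ∈ C.baseFunctionField K, HypCurve.HasDivisor h' (HypCurve.trace n F) ∧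
              ∃ c : k, c ≠ 0 ∧ h' = algebraMap k (C.FunctionField K) c * h) ↔
            ∃ j : Fin t → Fin n, F = ∑ i, HypCurve.frob (j i : ℕ) (E i))) ∧
      {F : C.Divisor K | HypCurve.IsReduced F ∧
        ∃ h' ∈ C.baseFunctionField K, HypCurve.HasDivisor h' (HypCurve.trace n F) ∧
          ∃ c : k, c ≠ 0 ∧ h' = algebraMap k (C.FunctionField K) c * h}.encard ≤
        ((n ^ C.g : ℕ) : ℕ∞) := by
  classical
  have hn0 : 0 < n := hn.pos
  have : IsAlgClosed K := IsAlgClosure.isAlgClosed k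
  have : Algebra.IsAlgebraic k K := IsAlgClosure.isAlgebraic
  have : Algebra.IsAlgebraic L K := Algebra.IsAlgebraic.tower_top (K := k) L
  have : FiniteDimensional k L := FiniteDimensional.of_finrank_pos (by omega)
  have : Finite L := Module.finite_of_finite k
  let _ : Fintype L := Fintype.ofFinite L
  have hcard : Fintype.card L = Fintype.card k ^ n := by
    rw [← hL]
    exact Module.card_eq_pow_finrank
  set A := pointsOf P with hAdef
  rw [divisorOf_eq_affineDivisor] at hD
  subst hD
  have hA : A.map (C.frobPoint K)^[n] = A := isRational_affineDivisor.1 hT.1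
  have hdec := exists_prime_decomposition (L := L) hcard hP hA
  have hprin := hT.2
  simp only [trace_affineDivisor] at hprin ⊢
  set T := traceMultiset (C.frobPoint K) n A with hTdef
  refine ⟨hdec, ?_, fun h hb hh => ?_⟩
  · obtain ⟨h, -, hh⟩ := hprin
    have hinv : T.map (C.frobPoint K) = T := by rw [hTdef, map_traceMultiset, traceMultiset_map hA]
    obtain ⟨c, hc, hcb⟩ := exists_const_mul_mem_base hh.count_eq hinv
    exact ⟨_, hcb, hh.const_mul hc⟩
  have huniq : ∀ h' ∈ C.baseFunctionField K, HasDivisor h' (C.affineDivisor K T) →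
      ∃ c : k, c ≠ 0 ∧ h' = algebraMap k (C.FunctionField K) c * h := fun h' hb' hh' =>
    eq_const_mul_of_hasOrderAt hb hb' hh.count_eq hh'.count_eq
  -- Scaling does not change the zeros, and the zeros determine the multiset; so agreement up to a
  -- constant is equality of traces.
  have htrace : ∀ B : Multiset (C.AffinePoint K),
      (∃ h' ∈ C.baseFunctionField K, HasDivisor h' (trace n (C.affineDivisor K B)) ∧
        ∃ c : k, c ≠ 0 ∧ h' = algebraMap k (C.FunctionField K) c * h) ↔
      traceMultiset (C.frobPoint K) n B = T := by
    intro B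
    rw [trace_affineDivisor]
    constructor
    · rintro ⟨_, hb', hh', c, hc, rfl⟩
      have h1 := hh.const_mul ((map_ne_zero (algebraMap k K)).2 hc)
      rw [← IsScalarTower.algebraMap_apply k K (C.FunctionField K)] at h1
      exact eq_of_hasOrderAt hh'.count_eq h1.count_eq
    · intro hB
      exact ⟨h, hb, hB ▸ hh, 1, one_ne_zero, by rw [map_one, one_mul]⟩
  have hiff : ∀ (t : ℕ) (E : Fin t → C.Divisor K), (∀ i, IsPrimeDivisor n L (E i)) →
      C.affineDivisor K A = ∑ i, E i → ∀ F : C.Divisor K, IsReduced F →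
      ((∃ h' ∈ C.baseFunctionField K, HasDivisor h' (trace n F) ∧
        ∃ c : k, c ≠ 0 ∧ h' = algebraMap k (C.FunctionField K) c * h) ↔
      ∃ j : Fin t → Fin n, F = ∑ i, frob (j i : ℕ) (E i)) := by
    intro t E hE hAE F hF
    obtain ⟨B, rfl⟩ := hF.exists_affineDivisor
    rw [htrace, trace_eq_iff_exists_frob hn0 hcard hA hE hAE]
  refine ⟨huniq, ?_, hiff, ?_⟩
  · obtain ⟨h₁, h₂, rfl, hspan⟩ := exists_polynomials_of_hasOrderAt hb hh.count_eq
    obtain ⟨c, hc, hN⟩ := norm_eq_prod hspan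
    set H := h₁ ^ 2 - C.f * h₂ ^ 2 with hH
    have hmap : H.map (algebraMap k K) = Polynomial.C c * xPoly T := by
      rw [xPoly, ← hN, hH]
      simp
    have hTcard : T.card = r * n := by
      rw [hTdef, card_traceMultiset, hAdef, card_pointsOf, mul_comm]
    have hdeg : H.degree = (r * n : ℕ) := by
      rw [← degree_map H (algebraMap k K), hmap, degree_C_mul hc,
        degree_eq_natDegree (monic_xPoly T).ne_zero, natDegree_xPoly, hTcard]
    -- The product of linear factors is monic, so c is the leading coefficient of a polynomial over
    -- `k` and hence rational.
    have hcH : algebraMap k K H.leadingCoeff = c := by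
      rw [← leadingCoeff_map, hmap, leadingCoeff_mul, leadingCoeff_C, (monic_xPoly T).leadingCoeff,
        mul_one]
    obtain ⟨d1, d2, d3, d4⟩ := DoubleCover.natDegree_of_degree_norm_eq C.natDegree_eq hdeg
    have e1 : ((r * n : ℕ) : ℚ) = n * r := by push_cast; ring
    refine ⟨h₁, h₂, rfl, hdeg, fun a => ?_, ⟨H.leadingCoeff, ?_, ?_⟩, fun h0 => ?_, fun h0 => ?_,
      fun hev => ?_, fun hr hn2 => ?_⟩
    · rw [← eval_map_algebraMap, hmap, eval_mul, eval_C, mul_eq_zero, or_iff_right hc,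
        eval_xPoly_eq_zero_iff]
      constructor
      · rintro ⟨R, hR, rfl⟩
        obtain ⟨j, hj, hR⟩ := Multiset.mem_sum.1 hR
        obtain ⟨S, hS, rfl⟩ := Multiset.mem_map.1 hR
        obtain ⟨i, rfl⟩ := mem_pointsOf.1 hS
        refine ⟨i, ⟨j, Finset.mem_range.1 hj⟩, ?_⟩
        rw [AffinePoint.map_pow, frobPoint]
      · rintro ⟨i, j, rfl⟩
        refine ⟨_, Multiset.mem_sum.2 ⟨j, Finset.mem_range.2 j.2, Multiset.mem_map_of_mem _
          (mem_pointsOf.2 ⟨i, rfl⟩)⟩, ?_⟩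
        rw [AffinePoint.map_pow, frobPoint]
    · intro h0
      rw [h0, map_zero] at hcH
      exact hc hcH.symm
    · rw [hcH, hmap, mumfordU_eq_xPoly, frobNorm_xPoly]
    · have h1 : (2 * h₁.natDegree : ℚ) ≤ (r * n : ℕ) := by exact_mod_cast d1 h0
      rw [Int.le_floor, Int.cast_natCast, ← e1]
      linarith
    · have h1 : (2 * C.g + 1 + 2 * h₂.natDegree : ℚ) ≤ (r * n : ℕ) := by exact_mod_cast d2 h0
      rw [Int.le_floor, Int.cast_natCast, ← e1]
      linarith
    · have hrn : Even (r * n) := by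
        rw [Nat.even_mul]
        rcases hev with h | rfl
        · exact Or.inl h
        · exact Or.inr even_two
      obtain ⟨h0, h1⟩ := d3 hrn
      refine ⟨h0, ?_⟩
      have h2 : (2 * h₁.natDegree : ℚ) = (r * n : ℕ) := by exact_mod_cast h1
      rw [← e1, ← h2, mul_div_cancel_left₀ _ two_ne_zero, Int.floor_natCast]
    -- A prime other than 2 is odd, so rn is odd and the term f h₂² attains the degree.
    · obtain ⟨h0, h1⟩ := d4 (hr.mul (hn.odd_of_ne_two hn2))
      refine ⟨h0, ?_⟩
      have h2 : (2 * C.g + 1 + 2 * h₂.natDegree : ℚ) = (r * n : ℕ) := by exact_mod_cast h1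
      rw [← e1, ← h2, show (2 * C.g + 1 + 2 * h₂.natDegree - 2 * C.g - 1 : ℚ) / 2 = h₂.natDegree by
        ring, Int.floor_natCast]
  · obtain ⟨t, E, hE, hAE⟩ := hdec
    have ht : t ≤ C.g := by
      refine (length_le_of_prime_decomposition hcard hE hAE).trans ?_
      rw [card_pointsOf]
      exact hP.1
    have hsub : {F : C.Divisor K | IsReduced F ∧ ∃ h' ∈ C.baseFunctionField K,
        HasDivisor h' (trace n F) ∧ ∃ c : k, c ≠ 0 ∧
          h' = algebraMap k (C.FunctionField K) c * h} ⊆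
        Set.range fun j : Fin t → Fin n => ∑ i, frob (j i : ℕ) (E i) := by
      rintro F ⟨hF, hF'⟩
      obtain ⟨j, hj⟩ := (hiff t E hE hAE F hF).1 hF'
      exact ⟨j, hj.symm⟩
    refine (Set.encard_le_encard hsub).trans ?_
    rw [← Set.image_univ]
    refine (Set.encard_image_le _ _).trans ?_
    rw [Set.encard_univ, ENat.card_eq_coe_fintype_card, Fintype.card_fun, Fintype.card_fin,
      Fintype.card_fin]
    exact_mod_cast Nat.pow_le_pow_right hn0 ht
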